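/- Graphs are finite, simple and undirected; an instance $(G,c)$ is a graph $G=(V,E)$ with edge costs $c\colon E\to\mathbb R_{\ge 0}$. For $U\subseteq V$ let $\delta(U)$ be the set of edges with exactly one endpoint in $U$, and write $c(F)=\sum_{e\in F}c(e)$, $\|c\|_p=(\sum_{e\in E}c(e)^p)^{1/p}$, $\|c\|_\infty=\max_{e\in E}c(e)$ (zero if $E=\emptyset$), and similarly for vertex weights $w\colon V\to\mathbb R_{\ge0}$. For an integer $k\ge 1$, a coloring $\chi\colon V\to[k]$ is strictly $w$-balanced if $\bigl|w(\chi^{-1}(i))-\|w\|_1/k\bigr|\le(1-1/k)\|w\|_\infty$ for all $i\in[k]$, and $$\partial^k_\infty(G,c)=\sup_{w\colon V\to\mathbb R_{\ge0}}\ \min_{\chi\ \text{strictly }w\text{-balanced}}\ \max_{i\in[k]}c(\delta(\chi^{-1}(i))).$$ The instance $(G,c)$ is well-behaved with parameters $(D,L)$ if every vertex has degree at most $D$ and $c(\delta(v))\le L\,c(e)$ for every vertex $v$ and every edge $e\in\delta(v)$ (bounded local cost fluctuation). A set $S\subseteq V$ is a $w$-balanced separator of $G$ if every connected component of $G[V\setminus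 S]$ has weight at most $\frac23\|w\|_1$; its cost is $\sum_{s\in S}c(\delta(s))$. The instance $(G,c)$ has a $p$-separator theorem with constant $C$ if for every $W\subseteq V$ and all weights $w\colon W\to\mathbb R_{\ge0}$ the induced instance $(G[W],c|_{E(W)})$ has a $w$-balanced separator of cost (computed in $G[W]$) at most $C\,\|c|_{E(W)}\|_p$. **Theorem.** (1) For all $p>1$, $D$, $L$ and $C$ there is a constant $K=K(p,D,L,C)$ such that, for every instance $(G,c)$ that is well-behaved with parameters $(D,L)$ and has a $p$-separator theorem with constant $C$, and for all integers $k\ge1$, $$\partial^k_\infty(G,c)\le K\left(\frac{\|c\|_p}{k^{1/p}}+\|c\|_\infty\right).$$ (2) For all $D$ and $L$ there is a constant $\kappa=\kappa(D,L)>0$ such that the following holds for all $p>1$, all $\alpha\ge0$ and every instance $(G,c)$ that is well-behaved with parameters $(D,L)$. If there are weights $w\colon V\to\mathbb R_{\ge0}$ with $\|w\|_\infty\le\|w\|_1/4$ such that every $w$-balanced separator of $G$ has cost at least $\alpha\|c\|_p$, then for every positive multiple $k$ of $4$ (in particular, for infinitely many $k$), the union $\tilde G$ of $k/4$ disjoint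 copies of $G$, with each edge given the cost $\tilde c$ of the corresponding edge of $G$, satisfies $$\partial^k_\infty(\tilde G,\tilde c)\ge\kappa\,\alpha\left(\frac{\|\tilde c\|_p}{k^{1/p}}+\|\tilde c\|_\infty\right).$$ -/

import Mathlib

open scoped NNReal ENNReal

universe u

noncomputable section

namespace MinMaxBoundary

/-! An instance is a finite simple graph `G` on `V` together with non-negative edge costs, given as a
function `c : Sym2 V → ℝ≥0`. Only the values of `c` on the edges of `G` are ever used. -/

section Costs

variable {V : Type u} [Fintype V]

open Classical in
/-- The `p`-norm of the edge costs `c` of `G`. -/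
def pNorm (G : SimpleGraph V) (c : Sym2 V → ℝ≥0) (p : ℝ) : ℝ≥0 :=
  (∑ e ∈ G.edgeFinset, c e ^ p) ^ (1 / p)

open Classical in
/-- The maximum edge cost of `G` (zero if `G` has no edge). -/
def supNorm (G : SimpleGraph V) (c : Sym2 V → ℝ≥0) : ℝ≥0 :=
  G.edgeFinset.sup c

open Classical in
/-- The cut `δ(U)`: the edges of `G` with exactly one endpoint in `U`. -/
def cut (G : SimpleGraph V) (U : Finset V) : Finset (Sym2 V) :=
  G.edgeFinset.filter fun e => ∃ u v, u ∈ U ∧ v ∉ U ∧ e = s(u, v)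

/-- The boundary cost `c(δ(U))`. -/
def boundaryCost (G : SimpleGraph V) (c : Sym2 V → ℝ≥0) (U : Finset V) : ℝ≥0 :=
  ∑ e ∈ cut G U, c e

open Classical in
/-- The instance `(G, c)` has maximum degree at most `D` and local fluctuation at most `L`, i.e.
`c(δ(v)) / min_{e ∈ δ(v)} c(e) ≤ L` for every vertex `v`, with the denominator cleared. -/
def WellBehaved (G : SimpleGraph V) (c : Sym2 V → ℝ≥0) (D : ℕ) (L : ℝ≥0) : Prop :=
  (∀ v : V, G.degree v ≤ D) ∧
    ∀ v : V, ∀ e ∈ cut G {v}, boundaryCost G c {v} ≤ L * c e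

end Costs

section Colorings

variable {V : Type u} [Fintype V]

/-- The color class `χ⁻¹(i)`. -/
def colorClass {k : ℕ} (χ : V → Fin k) (i : Fin k) : Finset V :=
  Finset.univ.filter fun v => χ v = i

/-- Strict balancedness of a `k`-coloring: the weight of every color class differs from the average
`‖w‖₁ / k` by at most `(1 - 1/k) ‖w‖_∞`. -/
def StrictlyBalanced (w : V → ℝ≥0) {k : ℕ} (χ : V → Fin k) : Prop :=
  ∀ i : Fin k,
    |((∑ v ∈ colorClass χ i, w v : ℝ≥0) : ℝ) - ((∑ v, w v : ℝ≥0) : ℝ) / k|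
      ≤ (1 - 1 / (k : ℝ)) * ((Finset.univ.sup w : ℝ≥0) : ℝ)

/-- The maximum boundary cost of a color class of `χ`. -/
def maxBoundaryCost (G : SimpleGraph V) (c : Sym2 V → ℝ≥0) {k : ℕ} (χ : V → Fin k) : ℝ≥0 :=
  Finset.univ.sup fun i : Fin k => boundaryCost G c (colorClass χ i)

/-- The min-max boundary `k`-decomposition cost: the supremum over all weights `w` of the minimum of
the maximum boundary cost over all strictly `w`-balanced `k`-colorings. -/
def decompositionCost (G : SimpleGraph V) (c : Sym2 V → ℝ≥0) (k : ℕ) : ℝ≥0∞ :=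
  ⨆ w : V → ℝ≥0, ⨅ χ : {χ : V → Fin k // StrictlyBalanced w χ},
    (maxBoundaryCost G c χ.1 : ℝ≥0∞)

end Colorings

section Separators

variable {V : Type u} [Fintype V]

open Classical in
/-- `S` is a `w`-balanced separator: each connected component of `G[V \ S]` has weight at most
`(2/3) ‖w‖₁`. -/
def IsBalancedSeparator (G : SimpleGraph V) (w : V → ℝ≥0) (S : Finset V) : Prop :=
  ∀ K : (G.induce {v | v ∉ S}).ConnectedComponent,
    ∑ v : {v | v ∉ S} with (G.induce {v | v ∉ S}).connectedComponentMk v = K, w v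
      ≤ 2 / 3 * ∑ v, w v

/-- The cost `∑_{s ∈ S} c(δ(s))` of a separator. -/
def separatorCost (G : SimpleGraph V) (c : Sym2 V → ℝ≥0) (S : Finset V) : ℝ≥0 :=
  ∑ s ∈ S, boundaryCost G c {s}

/-- The restriction of the edge costs to the induced subgraph `G[W]`. -/
def restrictCost (c : Sym2 V → ℝ≥0) (W : Set V) : Sym2 W → ℝ≥0 :=
  fun e => c (e.map Subtype.val)

open Classical in
/-- `(G, c)` has a `p`-separator theorem with constant `C`: for every vertex set `W` and all weights
`w` on `W`, the induced instance `(G[W], c|_W)` has a `w`-balanced separator of cost at most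
`C ‖c|_W‖_p`. -/
def HasSeparatorTheorem (G : SimpleGraph V) (c : Sym2 V → ℝ≥0) (p : ℝ) (C : ℝ≥0) : Prop :=
  ∀ (W : Set V) (w : W → ℝ≥0), ∃ S : Finset W,
    IsBalancedSeparator (G.induce W) w S ∧
      separatorCost (G.induce W) (restrictCost c W) S
        ≤ C * pNorm (G.induce W) (restrictCost c W) p

end Separators

section Copies

variable {V : Type u}

/-- The union of `m` disjoint copies of `G`. -/
def copies (G : SimpleGraph V) (m : ℕ) : SimpleGraph (Fin m × V) where
  Adj x y := x.1 = y.1 ∧ G.Adj x.2 y.2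
  symm := ⟨fun _ _ h => ⟨h.1.symm, h.2.symm⟩⟩
  loopless := ⟨fun _ h => G.loopless.irrefl _ h.2⟩

/-- Each edge of a copy has the cost of the corresponding edge of `G`. -/
def copiesCost (c : Sym2 V → ℝ≥0) (m : ℕ) : Sym2 (Fin m × V) → ℝ≥0 :=
  fun e => c (e.map Prod.snd)

end Copies

end MinMaxBoundary

end

open MinMaxBoundary

/-! Upper bound. Deleting a separator S splits a vertex set into non-adjacent parts, each with at
most 2/3 of the p-th powers of the costs. Listing the parts one after another, each recursively
ordered, and S last gives an order in which every prefix/suffix cut costs at most σ times the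
p-norm: the costs along the recursion form a geometric series with ratio (2/3)^(1/p)
(`HasCheapSeparators.hasCheapOrders`).

Let b dominate the costs at every vertex and ‖c‖_p / k^(1/p). Bisecting along cheap orders, about
log₂ k times, leaves O(k) pieces of p-norm O(b). The halved pieces have p-norm smaller by the factor
2^(1/p), while their number doubles; as p > 1, the last level dominates and the total cost cut is
O(k b) (`HasCheapOrders.exists_pieces`). Chopping each piece along its order by the cost leaving it
produces O(k) lists all of whose infixes have boundary O(b) (`HasCheapOrders.exists_fine_pieces`).

For balance, light lists are dealt out in groups of q, and the concatenated heavy lists fill every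
class up to the average weight. A class then meets only O(q) lists. Choosing a suitable rounding
threshold for the cut positions gives the sharp error (1 - 1/k)‖w‖_∞ (`exists_rounded_cuts`,
`exists_balanced_division`).

Lower bound. A strictly balanced coloring of the copies gives each color at most half the weight of
one copy, so the endpoints of bichromatic edges form a balanced separator there. Bounded fluctuation
charges each such vertex to one bichromatic edge, and averaging over copies and colors bounds the
maximum boundary from below (`separator_bound_le_maxBoundaryCost`). -/

namespace MinMaxBoundary

/-! ### Cut costs on multisets, cheap vertex orders, and division into pieces of small boundary -/

section CrossCost

variable {V : Type*}

/-- The total cost of the ordered pairs in `X × Y` (with multiplicity). -/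
noncomputable def crossCost (a : V → V → ℝ) (X Y : Multiset V) : ℝ :=
  (X.map fun x => (Y.map (a x)).sum).sum

variable {a : V → V → ℝ}

@[simp] lemma crossCost_zero_left (Y : Multiset V) : crossCost a 0 Y = 0 := by simp [crossCost]

@[simp] lemma crossCost_zero_right (X : Multiset V) : crossCost a X 0 = 0 := by simp [crossCost]

lemma crossCost_add_left (X X' Y : Multiset V) :
    crossCost a (X + X') Y = crossCost a X Y + crossCost a X' Y := by simp [crossCost]

lemma crossCost_add_right (X Y Y' : Multiset V) :
    crossCost a X (Y + Y') = crossCost a X Y + crossCost a X Y' := by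
  simp [crossCost, Multiset.sum_map_add]

lemma crossCost_nonneg (ha : ∀ x y, 0 ≤ a x y) (X Y : Multiset V) : 0 ≤ crossCost a X Y := by
  refine Multiset.sum_nonneg fun z hz => ?_
  obtain ⟨x, -, rfl⟩ := Multiset.mem_map.1 hz
  refine Multiset.sum_nonneg fun z hz => ?_
  obtain ⟨y, -, rfl⟩ := Multiset.mem_map.1 hz
  exact ha x y

lemma crossCost_comm (hs : ∀ x y, a x y = a y x) (X Y : Multiset V) :
    crossCost a X Y = crossCost a Y X := by
  unfold crossCost
  rw [Multiset.sum_map_sum_map]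
  simp only [hs]

lemma crossCost_mono (ha : ∀ x y, 0 ≤ a x y) {X X' Y Y' : Multiset V} (hX : X ≤ X')
    (hY : Y ≤ Y') : crossCost a X Y ≤ crossCost a X' Y' := by
  obtain ⟨Z, rfl⟩ := Multiset.le_iff_exists_add.1 hX
  obtain ⟨Z', rfl⟩ := Multiset.le_iff_exists_add.1 hY
  simp only [crossCost_add_left, crossCost_add_right]
  have h1 := crossCost_nonneg ha X Z'
  have h2 := crossCost_nonneg ha Z Y
  have h3 := crossCost_nonneg ha Z Z'
  linarith

/-- Twice the `p`-th power of the `p`-norm of the costs inside `X`. -/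
noncomputable def powerCost (a : V → V → ℝ) (p : ℝ) (X : Multiset V) : ℝ :=
  crossCost (fun x y => a x y ^ p) X X

lemma powerCost_nonneg (ha : ∀ x y, 0 ≤ a x y) (p : ℝ) (X : Multiset V) : 0 ≤ powerCost a p X :=
  crossCost_nonneg (fun x y => Real.rpow_nonneg (ha x y) p) X X

lemma powerCost_add_le (ha : ∀ x y, 0 ≤ a x y) (p : ℝ) (X Y : Multiset V) :
    powerCost a p X + powerCost a p Y ≤ powerCost a p (X + Y) := by
  have ha' : ∀ x y, 0 ≤ a x y ^ p := fun x y => Real.rpow_nonneg (ha x y) p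
  simp only [powerCost, crossCost_add_left, crossCost_add_right]
  have h1 := crossCost_nonneg ha' X Y
  have h2 := crossCost_nonneg ha' Y X
  linarith

/-- The cost of the pairs leaving `X` inside the ambient multiset `T`. -/
noncomputable def outerCost (a : V → V → ℝ) (T X : Multiset V) : ℝ :=
  crossCost a X T - crossCost a X X

@[simp] lemma outerCost_zero (T : Multiset V) : outerCost a T 0 = 0 := by simp [outerCost]

/-- Pairs between X and Y leave each of the two but not their sum. -/
lemma outerCost_add_le (ha : ∀ x y, 0 ≤ a x y) (T X Y : Multiset V) :
    outerCost a T (X + Y) ≤ outerCost a T X + outerCost a T Y := by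
  simp only [outerCost, crossCost_add_left, crossCost_add_right]
  have h1 := crossCost_nonneg ha X Y
  have h2 := crossCost_nonneg ha Y X
  linarith

/-- Every sub-multiset of `T` can be ordered so that each cut into a prefix and a suffix costs at
most `σ` times the `p`-norm of the costs inside. -/
def HasCheapOrders (a : V → V → ℝ) (p σ : ℝ) (T : Multiset V) : Prop :=
  ∀ W ≤ T, ∃ l : List V, (l : Multiset V) = W ∧
    ∀ l₁ l₂ : List V, l₁ ++ l₂ = l → crossCost a l₁ l₂ ≤ σ * powerCost a p W ^ (1 / p)

@[simp] lemma subperm_append_left_self (l m : List V) : l.Subperm (l ++ m) :=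
  (List.sublist_append_left l m).subperm

@[simp] lemma subperm_append_right_self (l m : List V) : m.Subperm (l ++ m) :=
  (List.sublist_append_right l m).subperm

/-- A cut of the concatenation falls inside a single list, and pairs from different lists cost
nothing. -/
lemma crossCost_flatten_split_le (ha : ∀ x y, 0 ≤ a x y) {t : ℝ} (ht : 0 ≤ t)
    (ls : List (List V)) (hpw : ls.Pairwise fun x y : List V => crossCost a x y = 0)
    (hls : ∀ x ∈ ls, ∀ l₁ l₂ : List V, l₁ ++ l₂ = x → crossCost a l₁ l₂ ≤ t) :
    ∀ l₁ l₂ : List V, l₁ ++ l₂ = ls.flatten → crossCost a l₁ l₂ ≤ t := by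
  induction ls with
  | nil =>
    intro l₁ l₂ h
    obtain ⟨rfl, rfl⟩ := List.append_eq_nil_iff.1 (by simpa using h)
    simpa using ht
  | cons x r ih =>
    intro l₁ l₂ h
    rw [List.pairwise_cons] at hpw
    have hxr : crossCost a (x : Multiset V) r.flatten = 0 := by
      have : ∀ r' : List (List V), (∀ y ∈ r', crossCost a (x : Multiset V) y = 0) →
          crossCost a (x : Multiset V) r'.flatten = 0 := by
        intro r'
        induction r' with
        | nil => intro _; simp
        | cons y r' ih' =>
          intro hy
          rw [List.flatten_cons, ← Multiset.coe_add, crossCost_add_right, hy y (by simp),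
            ih' fun z hz => hy z (by simp [hz])]
          simp
      exact this r hpw.1
    have ih' := ih hpw.2 fun y hy => hls y (by simp [hy])
    rw [List.flatten_cons, List.append_eq_append_iff] at h
    rcases h with ⟨m, rfl, rfl⟩ | ⟨m, rfl, hm⟩
    · rw [← Multiset.coe_add, crossCost_add_right]
      have h1 := hls _ (by simp) l₁ m rfl
      have h2 : crossCost a (l₁ : Multiset V) r.flatten ≤ 0 := by
        rw [← hxr, ← Multiset.coe_add]
        exact crossCost_mono ha (by simp) le_rfl
      linarith
    · rw [← Multiset.coe_add, crossCost_add_left]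
      have h1 := ih' m l₂ hm.symm
      have h2 : crossCost a (x : Multiset V) l₂ ≤ 0 := by
        rw [← hxr, hm, ← Multiset.coe_add]
        exact crossCost_mono ha le_rfl (by simp)
      linarith

/-- Every sub-multiset `W` of `T` has a separator `S` of cost at most `C` times the `p`-norm inside
`W`, whose removal leaves mutually non-adjacent parts, each with at most two thirds of the
`p`-th powers of the costs. -/
def HasCheapSeparators (a : V → V → ℝ) (p C : ℝ) (T : Multiset V) : Prop :=
  ∀ W ≤ T, ∃ (S : Multiset V) (Cs : List (Multiset V)), Cs.sum + S = W ∧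
    Cs.Pairwise (fun X Y => crossCost a X Y = 0) ∧
    (∀ X ∈ Cs, powerCost a p X ≤ 2 / 3 * powerCost a p W) ∧
    crossCost a W S ≤ C * powerCost a p W ^ (1 / p)

lemma coe_flatten_eq_sum (ls : List (List V)) :
    (ls.flatten : Multiset V) = (ls.map fun l : List V => (l : Multiset V)).sum := by
  induction ls with
  | nil => simp
  | cons x r ih => simp [← Multiset.coe_add, ih]

lemma le_sum_of_mem_list {X : Multiset V} {Cs : List (Multiset V)} (h : X ∈ Cs) : X ≤ Cs.sum :=
  List.single_le_sum (fun _ _ => Multiset.zero_le _) X h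

lemma crossCost_eq_zero_of_powerCost_eq_zero (ha : ∀ x y, 0 ≤ a x y) {p : ℝ} (hp : 0 < p)
    {W : Multiset V} (h : powerCost a p W = 0) : crossCost a W W = 0 := by
  have ha' : ∀ x y, 0 ≤ a x y ^ p := fun x y => Real.rpow_nonneg (ha x y) p
  have key : ∀ x ∈ W, ∀ y ∈ W, a x y = 0 := by
    intro x hx y hy
    have h1 : crossCost (fun x y => a x y ^ p) {x} {y} ≤ 0 := by
      rw [← h]
      exact crossCost_mono ha' (by simpa using hx) (by simpa using hy)
    simp only [crossCost, Multiset.map_singleton, Multiset.sum_singleton] at h1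
    exact (Real.rpow_eq_zero (ha x y) hp.ne').1 (le_antisymm h1 (ha' x y))
  unfold crossCost
  refine Multiset.sum_eq_zero fun z hz => ?_
  obtain ⟨x, hx, rfl⟩ := Multiset.mem_map.1 hz
  refine Multiset.sum_eq_zero fun z hz => ?_
  obtain ⟨y, hy, rfl⟩ := Multiset.mem_map.1 hz
  exact key x hx y hy

/-- A cut inside one part pays at most the bound for that part, whose norm has dropped by the factor
(2/3)^(1/p), plus all pairs into the separator. The condition `hC` says that σ absorbs this
recursion. -/
lemma HasCheapSeparators.hasCheapOrders (ha : ∀ x y, 0 ≤ a x y)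
    {p C σ : ℝ} (hp : 0 < p) (hσ : 0 ≤ σ) (hC : σ * (2 / 3) ^ (1 / p) + C ≤ σ)
    {T : Multiset V} (h : HasCheapSeparators a p C T) : HasCheapOrders a p σ T := by
  intro W
  induction W using Multiset.strongInductionOn with
  | _ W ih =>
  intro hWT
  -- If all costs inside W vanish, any order works. Otherwise a part with 2/3 of the powers is a
  -- proper part of W, which makes the induction well-founded.
  rcases (powerCost_nonneg ha p W).eq_or_lt with h0 | hpos
  · refine ⟨W.toList, by simp, fun l₁ l₂ hl => ?_⟩
    have hW : (l₁ : Multiset V) + (l₂ : Multiset V) = W := by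
      rw [Multiset.coe_add, hl, Multiset.coe_toList]
    have h1 : crossCost a (l₁ : Multiset V) l₂ ≤ crossCost a W W := by
      rw [← hW]; exact crossCost_mono ha (by simp) (by simp)
    rw [crossCost_eq_zero_of_powerCost_eq_zero ha hp h0.symm] at h1
    exact h1.trans (mul_nonneg hσ (Real.rpow_nonneg (powerCost_nonneg ha p W) _))
  obtain ⟨S, Cs, hsum, hpw, hX, hS⟩ := h W hWT
  have hlt : ∀ X ∈ Cs, X < W := by
    intro X hXC
    refine lt_of_le_of_ne ?_ ?_
    · rw [← hsum]; exact (le_sum_of_mem_list hXC).trans (by simp)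
    · rintro rfl
      have := hX _ hXC
      linarith
  have hord : ∀ X : Multiset V, ∃ l : List V, X ∈ Cs → (l : Multiset V) = X ∧
      ∀ l₁ l₂ : List V, l₁ ++ l₂ = l → crossCost a l₁ l₂ ≤ σ * powerCost a p X ^ (1 / p) := by
    intro X
    by_cases hXC : X ∈ Cs
    · obtain ⟨l, hl⟩ := ih X (hlt X hXC) ((hlt X hXC).le.trans hWT)
      exact ⟨l, fun _ => hl⟩
    · exact ⟨[], fun h => absurd h hXC⟩
  choose o ho using hord
  have hfl : (((Cs.map o).flatten : List V) : Multiset V) = Cs.sum := by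
    rw [coe_flatten_eq_sum (Cs.map o), List.map_map]
    congr 1
    conv_rhs => rw [← List.map_id Cs]
    exact List.map_congr_left fun X hXC => (ho X hXC).1
  set t := σ * (2 / 3 * powerCost a p W) ^ (1 / p) with ht
  have ht0 : 0 ≤ t := mul_nonneg hσ (Real.rpow_nonneg (by positivity) _)
  have hcut : ∀ l₁ l₂ : List V, l₁ ++ l₂ = (Cs.map o).flatten → crossCost a l₁ l₂ ≤ t := by
    refine crossCost_flatten_split_le ha ht0 _ ?_ ?_
    · rw [List.pairwise_map]
      refine hpw.imp_of_mem fun {X Y} hX' hY' hXY => ?_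
      rw [(ho X hX').1, (ho Y hY').1, hXY]
    · intro x hx l₁ l₂ hl
      obtain ⟨X, hXC, rfl⟩ := List.mem_map.1 hx
      refine ((ho X hXC).2 l₁ l₂ hl).trans ?_
      exact mul_le_mul_of_nonneg_left (Real.rpow_le_rpow (powerCost_nonneg ha p X) (hX X hXC)
        (by positivity)) hσ
  have hbound : t + C * powerCost a p W ^ (1 / p) ≤ σ * powerCost a p W ^ (1 / p) := by
    rw [ht, Real.mul_rpow (by norm_num) hpos.le, ← mul_assoc, ← add_mul]
    exact mul_le_mul_of_nonneg_right hC (Real.rpow_nonneg hpos.le _)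
  -- The separator goes last: a cut before it pays for one part and the pairs into S, a cut within
  -- it only for pairs into S.
  refine ⟨(Cs.map o).flatten ++ S.toList, ?_, fun l₁ l₂ hl => ?_⟩
  · rw [← Multiset.coe_add, hfl, Multiset.coe_toList, hsum]
  have hW : (l₁ : Multiset V) + l₂ = W := by
    rw [Multiset.coe_add, hl, ← Multiset.coe_add, hfl, Multiset.coe_toList, hsum]
  rw [List.append_eq_append_iff] at hl
  rcases hl with ⟨m, hm, rfl⟩ | ⟨m, rfl, hm⟩
  · rw [← Multiset.coe_add, crossCost_add_right, Multiset.coe_toList]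
    have h1 := hcut l₁ m hm.symm
    have h2 : crossCost a (l₁ : Multiset V) S ≤ crossCost a W S :=
      crossCost_mono ha (by rw [← hW]; simp) le_rfl
    linarith
  · have h2 : crossCost a (((Cs.map o).flatten ++ m : List V) : Multiset V) l₂ ≤
        crossCost a W S := by
      refine crossCost_mono ha (by rw [← hW]; exact Multiset.le_add_right _ _) ?_
      rw [← Multiset.coe_toList S, hm, ← Multiset.coe_add]
      simp
    linarith

lemma exists_maximal_prefix (P : List V → Prop) (h0 : P []) (l : List V) :
    P l ∨ ∃ l₁ v l₂, l = l₁ ++ v :: l₂ ∧ P l₁ ∧ ¬ P (l₁ ++ [v]) := by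
  induction l using List.reverseRecOn with
  | nil => exact Or.inl h0
  | append_singleton l v ih =>
    rcases ih with h | ⟨l₁, u, l₂, rfl, h1, h2⟩
    · by_cases hv : P (l ++ [v])
      · exact Or.inl hv
      · exact Or.inr ⟨l, v, [], rfl, h, hv⟩
    · exact Or.inr ⟨l₁, u, l₂ ++ [v], by simp, h1, h2⟩

/-- Split at the median vertex v of the cheap order: the entries before v and those after v each
carry at most half of the powers, and v becomes a piece of its own. With r = 2^(1/p), the bound
satisfies 2(2^n - r^n) + (2 - r)r^n = 2^(n+1) - r^(n+1), so `hκ` is what one split costs. -/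
lemma HasCheapOrders.exists_pieces (ha : ∀ x y, 0 ≤ a x y) (hs : ∀ x y, a x y = a y x)
    (hd : ∀ x, a x x = 0) {p σ b κ : ℝ} (hp : 1 < p) (hσ : 0 ≤ σ) (hb : 0 < b) (hκ0 : 0 ≤ κ)
    (hκ : 16 * σ ≤ κ * (2 - 2 ^ (1 / p))) {T : Multiset V} (h : HasCheapOrders a p σ T)
    (n : ℕ) : ∀ W ≤ T, powerCost a p W ≤ 2 ^ n * (2 * b ^ p) →
      ∃ Ps : List (Multiset V), Ps.sum = W ∧ Ps.length + 1 ≤ 2 ^ (n + 1) ∧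
        (∀ P ∈ Ps, powerCost a p P ≤ 2 * b ^ p) ∧
        crossCost a W W - (Ps.map fun P => crossCost a P P).sum
          ≤ κ * b * (2 ^ n - ((2 : ℝ) ^ (1 / p)) ^ n) := by
  have hp0 : 0 < p := by linarith
  have hr1 : (1 : ℝ) ≤ 2 ^ (1 / p) := Real.one_le_rpow (by norm_num) (by positivity)
  have hr2 : (2 : ℝ) ^ (1 / p) ≤ 2 := by
    calc (2 : ℝ) ^ (1 / p) ≤ 2 ^ (1 : ℝ) :=
          Real.rpow_le_rpow_of_exponent_le (by norm_num) (by rw [div_le_one hp0]; exact hp.le)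
      _ = 2 := by simp
  set r : ℝ := 2 ^ (1 / p) with hr
  have hbp : 0 < b ^ p := Real.rpow_pos_of_pos hb p
  induction n with
  | zero =>
    intro W _ hF
    refine ⟨[W], by simp, by simp, by simpa using hF, by simp⟩
  | succ n ih =>
    intro W hWT hF
    obtain ⟨l, hl, hcut⟩ := h W hWT
    have hF0 := powerCost_nonneg ha p W
    rcases exists_maximal_prefix (fun l : List V => powerCost a p l ≤ powerCost a p W / 2)
      (by rw [Multiset.coe_nil, powerCost, crossCost_zero_left]; exact div_nonneg hF0 zero_le_two) l
      with hle | ⟨l₁, v, l₂, rfl, h1, h2⟩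
    -- All of W lies below half its own power, so that power is zero and W is a single piece.
    · rw [hl] at hle
      refine ⟨[W], by simp, ?_, ?_, ?_⟩
      · have : 1 ≤ 2 ^ (n + 1) := Nat.one_le_two_pow
        rw [pow_succ]; simp; omega
      · intro P hP
        rw [List.mem_singleton.1 hP]
        nlinarith
      · have : r ^ (n + 1) ≤ 2 ^ (n + 1) := pow_le_pow_left₀ (by linarith) hr2 _
        simp only [List.map_cons, List.map_nil, List.sum_cons, List.sum_nil, add_zero, sub_self]
        have : 0 ≤ κ * b := by positivity
        nlinarith
    · push Not at h2
      have hWe : W = (l₁ : Multiset V) + ({v} + (l₂ : Multiset V)) := by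
        rw [← hl, ← Multiset.coe_add, ← Multiset.cons_coe, Multiset.singleton_add]
      have h3 : powerCost a p l₂ ≤ powerCost a p W / 2 := by
        have := powerCost_add_le ha p ((l₁ ++ [v] : List V) : Multiset V) l₂
        rw [Multiset.coe_add, List.append_assoc, List.singleton_append, hl] at this
        linarith
      have hhalf : powerCost a p W / 2 ≤ 2 ^ n * (2 * b ^ p) := by
        rw [pow_succ] at hF; linarith
      obtain ⟨P₁, s1, c1, f1, e1⟩ := ih l₁ (by refine le_trans ?_ hWT; rw [hWe]; simp)
        (h1.trans hhalf)
      obtain ⟨P₂, s2, c2, f2, e2⟩ := ih l₂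
        (by refine le_trans ?_ hWT; rw [hWe, ← add_assoc]; simp) (h3.trans hhalf)
      refine ⟨P₁ ++ {v} :: P₂, ?_, ?_, ?_, ?_⟩
      · simp [s1, s2, hWe]
      · simp only [List.length_append, List.length_cons]
        rw [pow_succ]; omega
      · intro P hP
        rw [List.mem_append, List.mem_cons] at hP
        rcases hP with hP | rfl | hP
        · exact f1 P hP
        · have : powerCost a p {v} = 0 := by
            simp [powerCost, crossCost, hd, Real.zero_rpow hp0.ne']
          rw [this]; positivity
        · exact f2 P hP
      · have k1 := hcut l₁ (v :: l₂) rfl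
        have k2 := hcut (l₁ ++ [v]) l₂ (by simp)
        have hroot : powerCost a p W ^ (1 / p) ≤ r ^ n * 4 * b := by
          calc powerCost a p W ^ (1 / p) ≤ (2 ^ (n + 1) * (2 * b ^ p)) ^ (1 / p) :=
                Real.rpow_le_rpow hF0 hF (by positivity)
            _ = r ^ (n + 1) * (r * b) := by
                rw [Real.mul_rpow (by positivity) (by positivity),
                  Real.mul_rpow (by positivity) hbp.le, ← Real.rpow_mul hb.le,
                  mul_one_div_cancel hp0.ne', Real.rpow_one, hr, ← Real.rpow_natCast,
                  ← Real.rpow_natCast, ← Real.rpow_mul (by norm_num),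
                  ← Real.rpow_mul (by norm_num), mul_comm (1 / p)]
            _ = r ^ n * (r * r) * b := by ring
            _ ≤ r ^ n * 4 * b := by
                have : r * r ≤ 4 := by nlinarith
                have : 0 < r ^ n := by positivity
                gcongr
        rw [← Multiset.coe_add, crossCost_add_left] at k2
        rw [← Multiset.cons_coe, ← Multiset.singleton_add, crossCost_add_right] at k1
        rw [Multiset.coe_singleton] at k2
        have q1 := crossCost_nonneg ha (l₁ : Multiset V) l₂
        have hk := mul_le_mul_of_nonneg_left hroot hσ
        -- The separated pairs lie in the cuts before and after v, and each is counted in both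
        -- directions. Two cuts, two directions and the factor 4 of `hroot` make the 16 of `hκ`.
        have hcr : crossCost a W W = crossCost a (l₁ : Multiset V) l₁ + crossCost a {v} {v} +
            crossCost a (l₂ : Multiset V) l₂ + 2 * (crossCost a (l₁ : Multiset V) {v} +
              crossCost a (l₁ : Multiset V) l₂ + crossCost a {v} (l₂ : Multiset V)) := by
          rw [hWe]
          simp only [crossCost_add_left, crossCost_add_right]
          rw [crossCost_comm hs {v} (l₁ : Multiset V), crossCost_comm hs (l₂ : Multiset V) l₁,
            crossCost_comm hs (l₂ : Multiset V) {v}]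
          ring
        simp only [List.map_append, List.map_cons, List.sum_append, List.sum_cons]
        rw [hcr]
        have hkey : 4 * (σ * (r ^ n * 4 * b)) ≤ κ * b * ((2 - r) * r ^ n) := by
          have : 0 ≤ r ^ n * b := by positivity
          nlinarith [mul_le_mul_of_nonneg_right hκ this]
        rw [pow_succ, pow_succ]
        nlinarith

lemma list_sum_map_sub {ι : Type*} (f g : ι → ℝ) (l : List ι) :
    (l.map fun i => f i - g i).sum = (l.map f).sum - (l.map g).sum := by
  induction l with
  | nil => simp
  | cons i l ih => simp only [List.map_cons, List.sum_cons, ih]; ring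

/-- Greedy from the right: the open chunk `h` is closed once its sum exceeds b. Thus closed chunks
sum to more than b, which bounds their number, and one more entry never leads beyond 2b. -/
lemma exists_chunks (g : V → ℝ) {b : ℝ} (hb : 0 ≤ b) (hg : ∀ v, g v ≤ b) (l : List V) :
    ∃ (h : List V) (ls : List (List V)), h ++ ls.flatten = l ∧ (h.map g).sum ≤ 2 * b ∧
      (∀ x ∈ ls, (x.map g).sum ≤ 2 * b) ∧ ls.length * b ≤ (ls.flatten.map g).sum := by
  induction l with
  | nil => exact ⟨[], [], by simp, by simpa using hb, by simp, by simp⟩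
  | cons v l ih =>
    obtain ⟨h, ls, rfl, h1, h2, h3⟩ := ih
    by_cases hh : (h.map g).sum ≤ b
    · refine ⟨v :: h, ls, by simp, ?_, h2, h3⟩
      rw [List.map_cons, List.sum_cons]
      linarith [hg v]
    · refine ⟨[v], h :: ls, by simp, ?_, ?_, ?_⟩
      · simpa using (hg v).trans (by linarith)
      · simpa using ⟨h1, h2⟩
      · push Not at hh
        simp only [List.length_cons, List.flatten_cons, List.map_append, List.sum_append]
        push_cast
        linarith

lemma crossCost_singleton_left_sum (l : List V) (T : Multiset V) :
    (l.map fun v => crossCost a {v} T).sum = crossCost a (l : Multiset V) T := by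
  induction l with
  | nil => simp
  | cons v l ih =>
    rw [List.map_cons, List.sum_cons, ih, ← Multiset.cons_coe, ← Multiset.singleton_add,
      crossCost_add_left]

/-- Pieces obtained by chopping the cheap order of one piece `P` according to the cost leaving
`P`. -/
lemma HasCheapOrders.exists_subdivision (ha : ∀ x y, 0 ≤ a x y) (hs : ∀ x y, a x y = a y x)
    {p σ b : ℝ} (hp : 1 < p) (hσ : 0 ≤ σ) (hb : 0 < b) {T : Multiset V}
    (h : HasCheapOrders a p σ T) (hdeg : ∀ v, crossCost a {v} T ≤ b) {P : Multiset V} (hP : P ≤ T)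
    (hpow : powerCost a p P ≤ 2 * b ^ p) :
    ∃ Ls : List (List V), (Ls.flatten : Multiset V) = P ∧
      Ls.length * b ≤ b + outerCost a T P ∧
      ∀ I ∈ Ls, ∀ J, J <:+: I → outerCost a T J ≤ (2 + 4 * σ) * b := by
  obtain ⟨l, hl, hcut⟩ := h P hP
  have hp0 : 0 < p := by linarith
  have hroot : σ * powerCost a p P ^ (1 / p) ≤ 2 * σ * b := by
    have : powerCost a p P ^ (1 / p) ≤ 2 * b := by
      calc powerCost a p P ^ (1 / p) ≤ (2 * b ^ p) ^ (1 / p) :=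
            Real.rpow_le_rpow (powerCost_nonneg ha p P) hpow (by positivity)
        _ = 2 ^ (1 / p) * b := by
            rw [Real.mul_rpow (by positivity) (by positivity), ← Real.rpow_mul hb.le,
              mul_one_div_cancel hp0.ne', Real.rpow_one]
        _ ≤ 2 ^ (1 : ℝ) * b := by
            gcongr
            · norm_num
            · rw [div_le_one hp0]; exact hp.le
        _ = 2 * b := by simp
    nlinarith
  -- The cost leaving P at v. Chunks bound this share of the boundary; the share inside P is bounded
  -- by the order.
  set g : V → ℝ := fun v => crossCost a {v} T - crossCost a {v} P with hg
  have hg0 : ∀ v, 0 ≤ g v := fun v => sub_nonneg.2 (crossCost_mono ha le_rfl hP)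
  have hgb : ∀ v, g v ≤ b := fun v => by
    have := crossCost_nonneg ha {v} P
    have := hdeg v
    simp only [hg]; linarith
  have hgsum : ∀ x : List V,
      (x.map g).sum = crossCost a (x : Multiset V) T - crossCost a (x : Multiset V) P := by
    intro x
    rw [← crossCost_singleton_left_sum, ← crossCost_singleton_left_sum, ← list_sum_map_sub]
  obtain ⟨hd, ls, hfl, h1, h2, h3⟩ := exists_chunks g hb.le hgb l
  refine ⟨hd :: ls, ?_, ?_, ?_⟩
  · rw [List.flatten_cons, hfl, hl]
  · have h4 : (ls.flatten.map g).sum ≤ (l.map g).sum := by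
      rw [← hfl, List.map_append, List.sum_append]
      have : 0 ≤ (hd.map g).sum := List.sum_nonneg (by simp [hg0])
      linarith
    rw [hgsum l, hl] at h4
    simp only [List.length_cons, outerCost]
    push_cast
    linarith
  · intro I hI J hJ
    have hIl : I <:+: l := by
      rw [← hfl, ← List.flatten_cons]
      exact List.infix_of_mem_flatten hI
    have hgI : (I.map g).sum ≤ 2 * b := by
      rcases List.mem_cons.1 hI with rfl | hI
      · exact h1
      · exact h2 I hI
    have hgJ : (J.map g).sum ≤ (I.map g).sum :=
      (hJ.sublist.map g).sum_le_sum (by simp [hg0])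
    -- Inside P, a pair leaving J goes to X or to Y, and so lies in one of the two cuts at the ends
    -- of J. Each costs at most 2σb, to which the 2b of the chunk is added.
    obtain ⟨X, Y, hXY⟩ := hJ.trans hIl
    have hJP : crossCost a (J : Multiset V) P = crossCost a (X : Multiset V) J
        + crossCost a (J : Multiset V) J + crossCost a (J : Multiset V) Y := by
      rw [← hl, ← hXY, ← Multiset.coe_add, ← Multiset.coe_add, crossCost_add_right,
        crossCost_add_right, crossCost_comm hs (J : Multiset V) X]
    have c1 := hcut X (J ++ Y) (by simpa using hXY)
    have c2 := hcut (X ++ J) Y hXY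
    rw [← Multiset.coe_add, crossCost_add_right] at c1
    rw [← Multiset.coe_add, crossCost_add_left] at c2
    have q := crossCost_nonneg ha (X : Multiset V) Y
    have := hgsum J
    simp only [outerCost]
    linarith

/-- A partition of `T` into `O(k)` lists of bounded outer cost, hereditarily for infixes. -/
lemma HasCheapOrders.exists_fine_pieces (ha : ∀ x y, 0 ≤ a x y) (hs : ∀ x y, a x y = a y x)
    (hd : ∀ x, a x x = 0) {p σ b κ : ℝ} (hp : 1 < p) (hσ : 0 ≤ σ) (hb : 0 < b) (hκ0 : 0 ≤ κ)
    (hκ : 16 * σ ≤ κ * (2 - 2 ^ (1 / p))) {T : Multiset V} (h : HasCheapOrders a p σ T)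
    (hdeg : ∀ v, crossCost a {v} T ≤ b) {k : ℕ} (hk : 0 < k)
    (hpow : powerCost a p T ≤ k * (2 * b ^ p)) :
    ∃ Ls : List (List V), (Ls.flatten : Multiset V) = T ∧
      (Ls.length : ℝ) ≤ (4 + 2 * κ) * k ∧
      ∀ I ∈ Ls, ∀ J, J <:+: I → outerCost a T J ≤ (2 + 4 * σ) * b := by
  -- The bisection depth: a power of two between k and 2k.
  obtain ⟨n, hn1, hn2⟩ : ∃ n : ℕ, k ≤ 2 ^ n ∧ 2 ^ n ≤ 2 * k := by
    refine ⟨Nat.log 2 k + 1, (Nat.lt_pow_succ_log_self (by norm_num) k).le, ?_⟩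
    rw [pow_succ, mul_comm]
    exact Nat.mul_le_mul_left 2 (Nat.pow_log_le_self 2 hk.ne')
  have hn1' : (k : ℝ) ≤ 2 ^ n := by exact_mod_cast hn1
  have hn2' : (2 : ℝ) ^ n ≤ 2 * k := by exact_mod_cast hn2
  have hbp : 0 < b ^ p := Real.rpow_pos_of_pos hb p
  obtain ⟨Ps, hsum, hlen, hPs, htot⟩ := h.exists_pieces ha hs hd hp hσ hb hκ0 hκ n T le_rfl
    (hpow.trans (by gcongr))
  have key : ∀ Qs : List (Multiset V), (∀ P ∈ Qs, P ≤ T ∧ powerCost a p P ≤ 2 * b ^ p) →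
      ∃ Ls : List (List V), (Ls.flatten : Multiset V) = Qs.sum ∧
        Ls.length * b ≤ Qs.length * b + (Qs.map fun P => outerCost a T P).sum ∧
        ∀ I ∈ Ls, ∀ J, J <:+: I → outerCost a T J ≤ (2 + 4 * σ) * b := by
    intro Qs
    induction Qs with
    | nil => intro _; exact ⟨[], by simp, by simp, by simp⟩
    | cons P Qs ih =>
      intro hQ
      obtain ⟨L₁, f1, n1, i1⟩ := ih fun P hP => hQ P (by simp [hP])
      obtain ⟨L₂, f2, n2, i2⟩ := h.exists_subdivision ha hs hp hσ hb hdeg (hQ P (by simp)).1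
        (hQ P (by simp)).2
      refine ⟨L₂ ++ L₁, ?_, ?_, ?_⟩
      · rw [List.flatten_append, ← Multiset.coe_add, f1, f2, List.sum_cons]
      · simp only [List.length_append, List.length_cons, List.map_cons, List.sum_cons]
        push_cast
        linarith
      · intro I hI
        rcases List.mem_append.1 hI with hI | hI
        · exact i2 I hI
        · exact i1 I hI
  obtain ⟨Ls, f, hl, hi⟩ := key Ps fun P hP => ⟨hsum ▸ le_sum_of_mem_list hP, hPs P hP⟩
  refine ⟨Ls, f.trans hsum, ?_, hi⟩
  have hout : (Ps.map fun P => outerCost a T P).sum ≤ κ * b * 2 ^ n := by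
    have hT : ∀ Qs : List (Multiset V),
        (Qs.map fun P => crossCost a P T).sum = crossCost a Qs.sum T := by
      intro Qs
      induction Qs with
      | nil => simp
      | cons P Qs ih => simp [ih, crossCost_add_left]
    simp only [outerCost]
    rw [list_sum_map_sub, hT, hsum]
    have : 0 ≤ κ * b * ((2 : ℝ) ^ (1 / p)) ^ n := by positivity
    linarith
  have hlen' : (Ps.length : ℝ) ≤ 2 ^ n * 2 := by
    have : Ps.length ≤ 2 ^ n * 2 := by rw [← pow_succ]; omega
    exact_mod_cast this
  have : (Ls.length : ℝ) * b ≤ ((4 + 2 * κ) * k) * b := by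
    have e1 : (Ps.length : ℝ) * b ≤ 4 * k * b := by gcongr; linarith
    have e2 : κ * b * 2 ^ n ≤ κ * b * (2 * k) := by gcongr
    linarith
  exact le_of_mul_le_mul_right this hb

end CrossCost
-- Rounding cut positions in a weighted list
section Rounding

variable {V : Type*}

/-- The weight of a list. -/
def listWeight (w : V → ℝ) (l : List V) : ℝ := (l.map w).sum

@[simp] lemma listWeight_nil (w : V → ℝ) : listWeight w [] = 0 := rfl

@[simp] lemma listWeight_cons (w : V → ℝ) (v : V) (l : List V) :
    listWeight w (v :: l) = w v + listWeight w l := by simp [listWeight]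

@[simp] lemma listWeight_append (w : V → ℝ) (l m : List V) :
    listWeight w (l ++ m) = listWeight w l + listWeight w m := by simp [listWeight]

lemma listWeight_nonneg {w : V → ℝ} (hw : ∀ v, 0 ≤ w v) (l : List V) : 0 ≤ listWeight w l :=
  List.sum_nonneg (by simp [hw])

/-- The consecutive entries of `H` with positions in `[a, b)`. -/
def slice (H : List V) (a b : ℕ) : List V := (H.drop a).take (b - a)

lemma take_append_slice (H : List V) {a b : ℕ} (h : a ≤ b) :
    H.take a ++ slice H a b = H.take b := by
  rw [slice, ← List.take_add, Nat.add_sub_cancel' h]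

lemma slice_append_slice (H : List V) {a b c : ℕ} (hab : a ≤ b) (hbc : b ≤ c) :
    slice H a b ++ slice H b c = slice H a c := by
  apply List.append_cancel_left (as := H.take a)
  rw [← List.append_assoc, take_append_slice H hab, take_append_slice H hbc,
    take_append_slice H (hab.trans hbc)]

lemma length_slice_le (H : List V) (a b : ℕ) : (slice H a b).length ≤ b - a :=
  List.length_take_le _ _

lemma slice_infix (H : List V) (a b : ℕ) : slice H a b <:+: H :=
  (List.take_prefix _ _).isInfix.trans (List.drop_suffix _ _).isInfix

lemma listWeight_slice (w : V → ℝ) (H : List V) {a b : ℕ} (h : a ≤ b) :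
    listWeight w (slice H a b) = listWeight w (H.take b) - listWeight w (H.take a) := by
  rw [← take_append_slice H h, listWeight_append]; ring

lemma listWeight_take_mono {w : V → ℝ} (hw : ∀ v, 0 ≤ w v) (H : List V) {a b : ℕ} (h : a ≤ b) :
    listWeight w (H.take a) ≤ listWeight w (H.take b) := by
  have := listWeight_nonneg hw (slice H a b)
  rw [listWeight_slice w H h] at this
  linarith

lemma listWeight_take_le_pred {w : V → ℝ} {M : ℝ} (hM0 : 0 ≤ M) (hM : ∀ v, w v ≤ M)
    (H : List V) (n : ℕ) :
    listWeight w (H.take n) ≤ listWeight w (H.take (n - 1)) + M := by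
  have h := listWeight_slice w H (Nat.sub_le n 1)
  have hl : (slice H (n - 1) n).length ≤ 1 := (length_slice_le H _ _).trans (by omega)
  have : listWeight w (slice H (n - 1) n) ≤ M := by
    match h' : slice H (n - 1) n, hl with
    | [], _ => simpa using hM0
    | [v], _ => simpa using hM v
  linarith

/-- Pigeonhole: the k - 1 values with 1 ≤ i < k cannot meet all k disjoint bins of width M/k. -/
lemma exists_empty_bin {k : ℕ} (hk : 0 < k) (M : ℝ) (β : ℕ → ℝ) :
    ∃ j < k, ∀ i, 1 ≤ i → i < k → β i < j * (M / k) ∨ (j + 1) * (M / k) ≤ β i := by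
  by_contra! hcon
  choose! f hf1 hf2 hf3 hf4 using hcon
  have hcard : (Finset.Ico 1 k).card < (Finset.range k).card := by simp; omega
  obtain ⟨x, hx, y, hy, hxy, he⟩ := Finset.exists_ne_map_eq_of_card_lt_of_maps_to hcard
    (f := f) fun j hj => by
      simp only [Finset.coe_range, Set.mem_Iio] at hj
      simpa using ⟨hf1 j hj, hf2 j hj⟩
  rw [Finset.mem_range] at hx hy
  wlog h : x < y generalizing x y
  · exact this y hy x hx hxy.symm he.symm (by omega)
  have h1 := hf4 x hx
  have h2 := hf3 y hy
  have h3 := hf3 x hx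
  rw [← he] at h2
  have h0 : 0 ≤ M / k := by nlinarith
  have : ((x : ℝ) + 1) ≤ y := by exact_mod_cast h
  nlinarith

/-- A weighted list can be cut at prescribed cumulative weights `t` into consecutive slices with
errors at most `(1 - 1/k) M`; up to one entry at each end, the slices obey the prescription. -/
lemma exists_rounded_cuts {w : V → ℝ} (hw : ∀ v, 0 ≤ w v) {M : ℝ} (hM0 : 0 ≤ M)
    (hM : ∀ v, w v ≤ M) (H : List V) {k : ℕ} (hk : 0 < k) (t : ℕ → ℝ)
    (ht : Monotone t) (ht0 : t 0 = 0) (htk : t k = listWeight w H) :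
    ∃ m : ℕ → ℕ, m 0 = 0 ∧ H.length ≤ m k ∧ ∀ i < k, m i ≤ m (i + 1) ∧
      |listWeight w (slice H (m i) (m (i + 1))) - (t (i + 1) - t i)| ≤ (1 - 1 / (k : ℝ)) * M ∧
      (m (i + 1) ≤ m i + 1 ∨ ∃ c d, m i ≤ c ∧ c ≤ m i + 1 ∧ c ≤ d ∧ d ≤ m (i + 1) ∧
        m (i + 1) ≤ d + 1 ∧ listWeight w (slice H c d) ≤ t (i + 1) - t i) := by
  classical
  set S : ℕ → ℝ := fun n => listWeight w (H.take n) with hS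
  have hSlen : ∀ n, H.length ≤ n → S n = t k := fun n hn => by
    simp only [hS]; rw [List.take_of_length_le hn, htk]
  have hSm : Monotone S := fun a b h => listWeight_take_mono hw H h
  -- The first position reaching the target t i. The extra 1 at i = k ensures that rounding down
  -- there still keeps the whole list.
  set n : ℕ → ℕ := fun i => if i < k then sInf {n | t i ≤ S n} else H.length + 1 with hn
  have hmem : ∀ i < k, t i ≤ S (sInf {n | t i ≤ S n}) := fun i hi =>
    Nat.sInf_mem (s := {n | t i ≤ S n}) ⟨H.length, by
      simp only [Set.mem_ofPred_eq, hSlen _ le_rfl]; exact ht hi.le⟩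
  have hn1 : ∀ i ≤ k, t i ≤ S (n i) := by
    intro i hi
    rcases hi.lt_or_eq with h | rfl
    · simp only [hn, if_pos h]; exact hmem i h
    · simp only [hn, lt_irrefl, if_false]; rw [hSlen _ (by omega)]
  have hn2 : ∀ i ≤ k, S (n i - 1) ≤ t i := by
    intro i hi
    rcases hi.lt_or_eq with h | rfl
    · simp only [hn, if_pos h]
      rcases Nat.eq_zero_or_pos (sInf {n | t i ≤ S n}) with h0 | h0
      · rw [h0]
        have : S (0 - 1) = t 0 := by simp [hS, ht0]
        rw [this]; exact ht (Nat.zero_le i)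
      · have := Nat.notMem_of_lt_sInf (s := {n | t i ≤ S n}) (Nat.sub_lt h0 one_pos)
        simp only [Set.mem_ofPred_eq, not_le] at this
        exact this.le
    · simp only [hn, lt_irrefl, if_false]; rw [hSlen _ (by omega)]
  have hn3 : ∀ i, S (n i) ≤ S (n i - 1) + M := fun i => listWeight_take_le_pred hM0 hM H (n i)
  have hn4 : ∀ i < k, n i ≤ n (i + 1) := by
    intro i hi
    by_cases h : i + 1 < k
    · simp only [hn, if_pos h, if_pos hi]
      exact Nat.sInf_le ((ht (Nat.le_succ i)).trans (hmem (i + 1) h))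
    · simp only [hn, if_pos hi, if_neg h]
      refine (Nat.sInf_le ?_).trans (Nat.le_succ _)
      simp only [Set.mem_ofPred_eq, hSlen _ le_rfl]
      exact ht hi.le
  have hn0 : n 0 = 0 := by
    simp only [hn, if_pos hk]
    exact Nat.le_zero.1 (Nat.sInf_le (by simp [hS, ht0]))
  have hnk : n k = H.length + 1 := by simp [hn]
  have hkpos : (0 : ℝ) < k := by exact_mod_cast hk
  -- No overshoot lies in [θ, θ + M/k). Those below θ are kept; the others are at least θ + M/k, and
  -- stepping back one entry lowers them by at most M.
  obtain ⟨j, hjk, hj⟩ := exists_empty_bin hk M fun i => S (n i) - t i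
  set θ : ℝ := j * (M / k) with hθ
  have hMk : 0 ≤ M / k := by positivity
  have hθ0 : 0 ≤ θ := by positivity
  have hθ1 : θ + M / k ≤ M := by
    have h1 : ((j : ℝ) + 1) ≤ k := by exact_mod_cast hjk
    calc θ + M / k = (j + 1) * (M / k) := by rw [hθ]; ring
      _ ≤ k * (M / k) := by gcongr
      _ = M := by field_simp
  set m : ℕ → ℕ := fun i => if S (n i) - t i < θ then n i else n i - 1 with hm
  have hm1 : ∀ i, m i = n i ∧ S (n i) - t i < θ ∨ m i = n i - 1 ∧ θ ≤ S (n i) - t i := by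
    intro i
    simp only [hm]
    split_ifs with h
    · exact Or.inl ⟨rfl, h⟩
    · exact Or.inr ⟨rfl, not_lt.1 h⟩
  have hm0 : m 0 = 0 := by rcases hm1 0 with h | h <;> rw [h.1, hn0]
  have hmk : H.length ≤ m k := by rcases hm1 k with h | h <;> rw [h.1, hnk] <;> omega
  -- All errors share a window of length M - M/k, so consecutive ones differ by at most (1 - 1/k)M.
  -- The window contains the zero errors at both ends.
  have herr : ∀ i ≤ k, S (m i) - t i ≤ θ ∧ θ + M / k - M ≤ S (m i) - t i := by
    intro i hi
    rcases Nat.eq_zero_or_pos i with rfl | hi0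
    · have : S 0 = 0 := by simp [hS]
      rw [hm0, this, ht0]; constructor <;> linarith
    rcases hi.lt_or_eq with hik | rfl
    · have e1 := hn1 i hi
      have e2 := hn2 i hi
      have e3 := hn3 i
      rcases hm1 i with ⟨h, h'⟩ | ⟨h, h'⟩
      · rw [h]; constructor <;> linarith
      · have := hj i hi0 hik
        rw [h]
        refine ⟨by linarith, ?_⟩
        rcases this with h | h
        · linarith
        · have : ((j : ℝ) + 1) * (M / k) = θ + M / k := by rw [hθ]; ring
          linarith
    · rw [hSlen _ hmk]; constructor <;> linarith
  have hmono : ∀ i < k, m i ≤ m (i + 1) := by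
    intro i hi
    have h4 := hn4 i hi
    rcases hm1 i with ⟨h, h'⟩ | ⟨h, h'⟩ <;> rcases hm1 (i + 1) with ⟨g, g'⟩ | ⟨g, g'⟩
    · omega
    -- Order could fail only if n i = n (i + 1) with i kept and i + 1 stepped back; but the later
    -- target is no smaller, so its overshoot is no larger.
    · rcases h4.lt_or_eq with h5 | h5
      · omega
      · rw [← h5] at g'
        have := ht (Nat.le_succ i)
        simp only [Nat.succ_eq_add_one] at this
        linarith
    · omega
    · omega
  refine ⟨m, hm0, hmk, fun i hi => ⟨hmono i hi, ?_, ?_⟩⟩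
  · rw [listWeight_slice w H (hmono i hi)]
    obtain ⟨a1, a2⟩ := herr i hi.le
    obtain ⟨b1, b2⟩ := herr (i + 1) hi
    have : (1 - 1 / (k : ℝ)) * M = M - M / k := by ring
    simp only [hS] at a1 a2 b1 b2
    rw [this, abs_le]; constructor <;> linarith
  · have h4 := hn4 i hi
    have c1 : m i ≤ n i ∧ n i ≤ m i + 1 := by rcases hm1 i with h | h <;> omega
    have c2 : m (i + 1) ≤ n (i + 1) ∧ n (i + 1) - 1 ≤ m (i + 1) := by
      rcases hm1 (i + 1) with h | h <;> omega
    by_cases h5 : n i ≤ n (i + 1) - 1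
    -- This core starts once t i is reached and stops before t (i + 1) is exceeded.
    · refine Or.inr ⟨n i, n (i + 1) - 1, c1.1, c1.2, h5, c2.2, by omega, ?_⟩
      rw [listWeight_slice w H h5]
      have e1 := hn1 i hi.le
      have e2 := hn2 (i + 1) hi
      simp only [hS] at e1 e2
      linarith
    · exact Or.inl (by omega)

end Rounding

/-! ### Balanced division of short-boundary lists into classes -/

section Balancing

variable {V : Type*} {a : V → V → ℝ}

/-- A prefix consists of N full lists, each heavier than η, and part of one more. The case N = 0 is
separate because the strict inequality may fail there. -/
lemma exists_count_of_prefix (ha : ∀ x y, 0 ≤ a x y) {w : V → ℝ} (hw : ∀ v, 0 ≤ w v)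
    {T : Multiset V} {B η : ℝ} (hB : 0 ≤ B) (ls : List (List V))
    (hls : ∀ I ∈ ls, η < listWeight w I ∧ ∀ J, J <:+: I → outerCost a T J ≤ B) :
    ∀ J, J <+: ls.flatten → ∃ N : ℕ, outerCost a T J ≤ (N + 1) * B ∧
      (N = 0 ∨ N * η < listWeight w J) := by
  induction ls with
  | nil =>
    intro J hJ
    obtain rfl : J = [] := by simpa using hJ
    exact ⟨0, by simpa using hB, Or.inl rfl⟩
  | cons x r ih =>
    rintro J ⟨Z, hZ⟩
    obtain ⟨hx1, hx2⟩ := hls x (by simp)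
    rw [List.flatten_cons, List.append_eq_append_iff] at hZ
    rcases hZ with ⟨m, rfl, -⟩ | ⟨m, rfl, hm⟩
    · exact ⟨0, by simpa using hx2 J (List.infix_append_left), Or.inl rfl⟩
    · obtain ⟨N, h1, h2⟩ := ih (fun I hI => hls I (by simp [hI])) m ⟨Z, hm.symm⟩
      refine ⟨N + 1, ?_, Or.inr ?_⟩
      · have := outerCost_add_le ha T x m
        have := hx2 x List.infix_rfl
        rw [← Multiset.coe_add]
        push_cast
        linarith
      · have := listWeight_nonneg hw m
        rw [listWeight_append]
        push_cast
        rcases h2 with rfl | h2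
        · push_cast; linarith
        · linarith

/-- As for prefixes, with a further partial list at the left end. -/
lemma exists_count_of_infix (ha : ∀ x y, 0 ≤ a x y) {w : V → ℝ} (hw : ∀ v, 0 ≤ w v)
    {T : Multiset V} {B η : ℝ} (hB : 0 ≤ B) (ls : List (List V))
    (hls : ∀ I ∈ ls, η < listWeight w I ∧ ∀ J, J <:+: I → outerCost a T J ≤ B) :
    ∀ J, J <:+: ls.flatten → ∃ N : ℕ, outerCost a T J ≤ (N + 2) * B ∧
      (N = 0 ∨ N * η < listWeight w J) := by
  induction ls with
  | nil =>
    intro J hJ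
    obtain rfl : J = [] := by simpa using hJ
    exact ⟨0, by simpa using hB, Or.inl rfl⟩
  | cons x r ih =>
    intro J hJ
    obtain ⟨hx1, hx2⟩ := hls x (by simp)
    have hr : ∀ I ∈ r, η < listWeight w I ∧ ∀ J, J <:+: I → outerCost a T J ≤ B :=
      fun I hI => hls I (by simp [hI])
    rw [List.flatten_cons, List.infix_append_iff] at hJ
    rcases hJ with hJ | hJ | ⟨s, u, rfl, hs, hu⟩
    · refine ⟨0, ?_, Or.inl rfl⟩
      have := hx2 J hJ
      push_cast; linarith
    · exact ih hr J hJ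
    · obtain ⟨N, h1, h2⟩ := exists_count_of_prefix ha hw hB r hr u hu
      refine ⟨N, ?_, ?_⟩
      · have := outerCost_add_le ha T s u
        have := hx2 s hs.isInfix
        rw [← Multiset.coe_add]
        linarith
      · have := listWeight_nonneg hw s
        rw [listWeight_append]
        rcases h2 with rfl | h2
        · exact Or.inl rfl
        · right; linarith

lemma outerCost_flatten_le (ha : ∀ x y, 0 ≤ a x y) {T : Multiset V} {B : ℝ} (ls : List (List V))
    (h : ∀ I ∈ ls, outerCost a T I ≤ B) : outerCost a T (ls.flatten : List V) ≤ ls.length * B := by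
  induction ls with
  | nil => simp
  | cons x r ih =>
    have h1 := outerCost_add_le ha T x (r.flatten : List V)
    have h2 := ih fun I hI => h I (by simp [hI])
    have h3 := h x (by simp)
    rw [List.flatten_cons, ← Multiset.coe_add, List.length_cons]
    push_cast
    linarith

lemma listWeight_flatten_le {w : V → ℝ} {η : ℝ} (ls : List (List V))
    (h : ∀ I ∈ ls, listWeight w I ≤ η) : listWeight w ls.flatten ≤ ls.length * η := by
  induction ls with
  | nil => simp
  | cons x r ih =>
    have h2 := ih fun I hI => h I (by simp [hI])
    have h3 := h x (by simp)
    rw [List.flatten_cons, listWeight_append, List.length_cons]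
    push_cast
    linarith

lemma outerCost_le_of_length_le_one {T : Multiset V} {B : ℝ} (hB : 0 ≤ B)
    (h : ∀ v, outerCost a T {v} ≤ B) {l : List V} (hl : l.length ≤ 1) : outerCost a T l ≤ B := by
  match l, hl with
  | [], _ => simpa using hB
  | [v], _ => simpa using h v

lemma coe_filter_add_coe_filter_not {ι : Type*} (p : ι → Prop) [DecidablePred p] (l : List ι) :
    ((l.filter p : List ι) : Multiset ι) + ((l.filter fun x => ¬ p x : List ι) : Multiset ι)
      = l := by
  have := Multiset.filter_add_not p (l : Multiset ι)
  simpa only [Multiset.filter_coe] using this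

/-- If `T` is divided into at most `q k` lists all of whose infixes have outer cost at most `B`,
then `T` has a strictly balanced division into `k` classes of outer cost `O(q B)`. -/
lemma exists_balanced_division (ha : ∀ x y, 0 ≤ a x y) {w : V → ℝ} (hw : ∀ v, 0 ≤ w v) {M : ℝ}
    (hM0 : 0 ≤ M) (hM : ∀ v, w v ≤ M) {T : Multiset V} {B : ℝ} (hB : 0 ≤ B) {k q : ℕ} (hk : 0 < k)
    (hq : 0 < q) (Ls : List (List V)) (hT : (Ls.flatten : Multiset V) = T)
    (hlen : Ls.length ≤ q * k) (hLs : ∀ I ∈ Ls, ∀ J, J <:+: I → outerCost a T J ≤ B)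
    (hsing : ∀ v, outerCost a T {v} ≤ B) :
    ∃ Cl : ℕ → Multiset V, ∑ i ∈ Finset.range k, Cl i = T ∧ ∀ i < k,
      outerCost a T (Cl i) ≤ (2 * q + 4) * B ∧
      |((Cl i).map w).sum - (T.map w).sum / k| ≤ (1 - 1 / (k : ℝ)) * M := by
  classical
  have hkpos : (0 : ℝ) < k := by exact_mod_cast hk
  have hqpos : (0 : ℝ) < q := by exact_mod_cast hq
  set A : ℝ := (T.map w).sum / k with hA
  have hTw : 0 ≤ (T.map w).sum := Multiset.sum_nonneg fun z hz => by
    obtain ⟨x, -, rfl⟩ := Multiset.mem_map.1 hz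
    exact hw x
  have hA0 : 0 ≤ A := by positivity
  -- With this threshold q light lists weigh at most the average A, and a slice of weight at most A
  -- contains at most q full heavy lists.
  set η : ℝ := A / q with hη
  have hη0 : 0 ≤ η := by positivity
  have hqη : q * η = A := by rw [hη]; field_simp
  set Lt := Ls.filter fun I => listWeight w I ≤ η with hLt
  set Hv := Ls.filter fun I => ¬ listWeight w I ≤ η with hHv
  set H := Hv.flatten with hH
  have hsplit : (Lt.flatten : Multiset V) + (H : Multiset V) = T := by
    rw [← hT, hH, Multiset.coe_add, ← List.flatten_append, Multiset.coe_eq_coe]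
    apply List.Perm.flatten
    have := coe_filter_add_coe_filter_not (fun I : List V => listWeight w I ≤ η) Ls
    rwa [Multiset.coe_add, Multiset.coe_eq_coe] at this
  set g : ℕ → List (List V) := fun i => slice Lt (q * i) (q * (i + 1)) with hg
  have hgl : ∀ i, (g i).length ≤ q := fun i =>
    (length_slice_le _ _ _).trans (by rw [mul_add, mul_one]; omega)
  have hgm : ∀ i, ∀ I ∈ g i, I ∈ Ls ∧ listWeight w I ≤ η := fun i I hI => by
    have := (slice_infix _ _ _).subset hI
    simpa [hLt] using this
  have hgsum : ∀ n, ∑ i ∈ Finset.range n, ((g i).flatten : Multiset V)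
      = ((Lt.take (q * n)).flatten : List V) := by
    intro n
    induction n with
    | zero => simp
    | succ n ih =>
      rw [Finset.sum_range_succ, ih, Multiset.coe_add, ← List.flatten_append,
        take_append_slice _ (Nat.mul_le_mul_left q (Nat.le_succ n))]
  have hgk : ∑ i ∈ Finset.range k, ((g i).flatten : Multiset V) = (Lt.flatten : List V) := by
    rw [hgsum k, List.take_of_length_le]
    exact (List.length_filter_le _ _).trans hlen
  set x : ℕ → ℝ := fun i => listWeight w (g i).flatten with hx
  have hxA : ∀ i, x i ≤ A := fun i => by
    refine (listWeight_flatten_le (g i) fun I hI => (hgm i I hI).2).trans ?_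
    rw [← hqη]
    have : ((g i).length : ℝ) ≤ q := by exact_mod_cast hgl i
    gcongr
  -- Class i still lacks A - x i after its light lists. The deficits are non-negative and sum to the
  -- heavy weight, so the rounding error of a slice is the error of its class.
  set t : ℕ → ℝ := fun n => ∑ i ∈ Finset.range n, (A - x i) with ht
  have htm : Monotone t := monotone_nat_of_le_succ fun n => by
    simp only [ht, Finset.sum_range_succ]
    linarith [hxA n]
  have hwt : ∀ l : List V, ((l : Multiset V).map w).sum = listWeight w l := fun l => by
    simp [listWeight]
  have hsumw : ∀ (n : ℕ) (f : ℕ → Multiset V), ((∑ i ∈ Finset.range n, f i).map w).sum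
      = ∑ i ∈ Finset.range n, ((f i).map w).sum := by
    intro n f
    induction n with
    | zero => simp
    | succ n ih => simp [Finset.sum_range_succ, ih]
  have htk : t k = listWeight w H := by
    have h1 : ∑ i ∈ Finset.range k, x i = listWeight w Lt.flatten := by
      rw [← hwt, ← hgk, hsumw]
      exact Finset.sum_congr rfl fun i _ => (hwt _).symm
    have h2 : (T.map w).sum = listWeight w Lt.flatten + listWeight w H := by
      rw [← hsplit, Multiset.map_add, Multiset.sum_add, hwt, hwt]
    simp only [ht]
    rw [Finset.sum_sub_distrib, h1, Finset.sum_const, Finset.card_range, nsmul_eq_mul, hA,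
      mul_div_cancel₀ _ hkpos.ne', h2]
    ring
  obtain ⟨m, hm0, hmk, hm⟩ := exists_rounded_cuts hw hM0 hM H hk t htm (by simp [ht]) htk
  have hHsum : ∀ n ≤ k, ∑ i ∈ Finset.range n, (slice H (m i) (m (i + 1)) : Multiset V)
      = (H.take (m n) : List V) := by
    intro n
    induction n with
    | zero => intro _; simp [hm0]
    | succ n ih =>
      intro hn
      rw [Finset.sum_range_succ, ih (by omega), Multiset.coe_add,
        take_append_slice _ (hm n hn).1]
  have htd : ∀ i, t (i + 1) - t i = A - x i := fun i => by
    simp only [ht, Finset.sum_range_succ]; ring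
  refine ⟨fun i => ((g i).flatten : Multiset V) + (slice H (m i) (m (i + 1)) : Multiset V),
    ?_, fun i hi => ⟨?_, ?_⟩⟩
  · rw [Finset.sum_add_distrib, hgk, hHsum k le_rfl, List.take_of_length_le hmk, hsplit]
  · have h1 : outerCost a T (g i).flatten ≤ q * B := by
      refine (outerCost_flatten_le ha (g i) fun I hI =>
        hLs I (hgm i I hI).1 I List.infix_rfl).trans ?_
      have : ((g i).length : ℝ) ≤ q := by exact_mod_cast hgl i
      gcongr
    -- At most q full lists and two partial ones in the core, plus at most one entry at each end
    -- from rounding.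
    have h2 : outerCost a T (slice H (m i) (m (i + 1))) ≤ (q + 4) * B := by
      obtain ⟨hmi, -, hcase⟩ := hm i hi
      rcases hcase with hone | ⟨c, d, hc1, hc2, hcd, hd1, hd2, hcore⟩
      · have := outerCost_le_of_length_le_one hB hsing
          ((length_slice_le H (m i) (m (i + 1))).trans (by omega))
        nlinarith
      · rw [← slice_append_slice H hc1 (hcd.trans hd1), ← slice_append_slice H hcd hd1]
        have e1 := outerCost_le_of_length_le_one hB hsing
          ((length_slice_le H (m i) c).trans (by omega))
        have e2 := outerCost_le_of_length_le_one hB hsing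
          ((length_slice_le H d (m (i + 1))).trans (by omega))
        have e3 : outerCost a T (slice H c d) ≤ (q + 2) * B := by
          obtain ⟨N, hN1, hN2⟩ := exists_count_of_infix ha hw hB Hv (η := η) (T := T)
            (fun I hI => by
              simp only [hHv, List.mem_filter, decide_eq_true_eq, not_le] at hI
              exact ⟨hI.2, hLs I hI.1⟩) _ (slice_infix H c d)
          refine hN1.trans ?_
          have hNq : (N : ℝ) ≤ q := by
            rcases hN2 with rfl | hN2
            · simp
            · rw [htd i] at hcore
              have hxi := listWeight_nonneg hw (g i).flatten
              have : (N : ℝ) * η < q * η := by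
                rw [hqη]; simp only [hx] at hcore; linarith
              exact (lt_of_mul_lt_mul_right this hη0).le
          gcongr
        have f1 := outerCost_add_le ha T (slice H (m i) c)
          (slice H c d ++ slice H d (m (i + 1)) : List V)
        have f2 := outerCost_add_le ha T (slice H c d) (slice H d (m (i + 1)))
        rw [Multiset.coe_add] at f1 f2
        linarith
    have := outerCost_add_le ha T ((g i).flatten : List V) (slice H (m i) (m (i + 1)))
    linarith
  · obtain ⟨-, herr, -⟩ := hm i hi
    rw [htd i] at herr
    rw [Multiset.map_add, Multiset.sum_add, hwt, hwt]
    convert herr using 2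
    simp only [hx]; ring

end Balancing
-- From graphs to pair costs and back
section Graphs

variable {V : Type*} {G : SimpleGraph V} {c : Sym2 V → ℝ≥0}

open Classical in
/-- The cost of the edge between `x` and `y`, zero if there is none. -/
noncomputable def adjCost (G : SimpleGraph V) (c : Sym2 V → ℝ≥0) (x y : V) : ℝ :=
  if G.Adj x y then c s(x, y) else 0

lemma adjCost_nonneg (x y : V) : 0 ≤ adjCost G c x y := by
  unfold adjCost; split_ifs <;> simp

lemma adjCost_comm (x y : V) : adjCost G c x y = adjCost G c y x := by
  by_cases h : G.Adj x y
  · rw [adjCost, adjCost, if_pos h, if_pos h.symm, Sym2.eq_swap]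
  · rw [adjCost, adjCost, if_neg h, if_neg fun h' => h h'.symm]

@[simp] lemma adjCost_self (x : V) : adjCost G c x x = 0 := by simp [adjCost]

lemma adjCost_of_adj {x y : V} (h : G.Adj x y) : adjCost G c x y = c s(x, y) := by
  simp [adjCost, h]

lemma adjCost_of_not_adj {x y : V} (h : ¬ G.Adj x y) : adjCost G c x y = 0 := by
  simp [adjCost, h]

lemma adjCost_induce (W : Set V) (x y : W) :
    adjCost (G.induce W) (restrictCost c W) x y = adjCost G c x y := by
  by_cases h : G.Adj (x : V) y
  · rw [adjCost_of_adj h, adjCost_of_adj (by simpa using h)]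
    simp [restrictCost]
  · rw [adjCost_of_not_adj h, adjCost_of_not_adj (by simpa using h)]

lemma sum_singleton_eq_map {ι : Type*} (s : Finset ι) (f : ι → V) :
    ∑ i ∈ s, ({f i} : Multiset V) = s.val.map f := by
  rw [← Multiset.sum_map_singleton (s.val.map f), Multiset.map_map]
  rfl

lemma crossCost_sum_singleton {ι κ : Type*} (a : V → V → ℝ) (s : Finset ι) (t : Finset κ)
    (f : ι → V) (g : κ → V) :
    crossCost a (∑ i ∈ s, {f i}) (∑ j ∈ t, {g j}) = ∑ i ∈ s, ∑ j ∈ t, a (f i) (g j) := by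
  rw [sum_singleton_eq_map, sum_singleton_eq_map]
  simp only [crossCost, Multiset.map_map]
  rfl

lemma sum_singleton_eq_val (s : Finset V) : ∑ v ∈ s, ({v} : Multiset V) = s.val :=
  Finset.sum_multiset_singleton s

lemma crossCost_val (a : V → V → ℝ) (X Y : Finset V) :
    crossCost a X.val Y.val = ∑ x ∈ X, ∑ y ∈ Y, a x y := rfl

variable [Fintype V]

open Classical in
lemma boundaryCost_eq_sum (U : Finset V) :
    (boundaryCost G c U : ℝ) = ∑ u ∈ U, ∑ v ∈ Uᶜ, adjCost G c u v := by
  rw [← Finset.sum_product']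
  have h : ∑ x ∈ U ×ˢ Uᶜ, adjCost G c x.1 x.2
      = ∑ x ∈ (U ×ˢ Uᶜ).filter (fun x => G.Adj x.1 x.2), (c s(x.1, x.2) : ℝ) := by
    rw [Finset.sum_filter]; rfl
  rw [h, boundaryCost, NNReal.coe_sum]
  symm
  refine Finset.sum_bij (fun x _ => s(x.1, x.2)) ?_ ?_ ?_ ?_
  · rintro ⟨x, y⟩ hx
    simp only [Finset.mem_filter, Finset.mem_product, Finset.mem_compl] at hx
    simp only [cut, Finset.mem_filter, SimpleGraph.mem_edgeFinset, SimpleGraph.mem_edgeSet]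
    exact ⟨hx.2, x, y, hx.1.1, hx.1.2, rfl⟩
  · rintro ⟨x, y⟩ hx ⟨x', y'⟩ hx' he
    simp only [Finset.mem_filter, Finset.mem_product, Finset.mem_compl] at hx hx'
    rcases Sym2.eq_iff.1 he with ⟨rfl, rfl⟩ | ⟨rfl, rfl⟩
    · rfl
    · exact absurd hx.1.1 hx'.1.2
  · intro e he
    simp only [cut, Finset.mem_filter, SimpleGraph.mem_edgeFinset] at he
    obtain ⟨he, x, y, hx, hy, rfl⟩ := he
    exact ⟨(x, y), by simpa [hx, hy] using he, rfl⟩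
  · intro x _; rfl

open Classical in
lemma boundaryCost_singleton (v : V) :
    (boundaryCost G c {v} : ℝ) = ∑ y, adjCost G c v y := by
  rw [boundaryCost_eq_sum, Finset.sum_singleton, ← Finset.sum_compl_add_sum {v}]
  simp

open Classical in
lemma boundaryCost_eq_outerCost (U : Finset V) :
    (boundaryCost G c U : ℝ) = outerCost (adjCost G c) Finset.univ.val U.val := by
  rw [boundaryCost_eq_sum, outerCost, crossCost_val, crossCost_val, ← Finset.sum_sub_distrib]
  refine Finset.sum_congr rfl fun u _ => ?_
  rw [← Finset.sum_compl_add_sum U]; ring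

open Classical in
lemma two_mul_sum_edgeFinset (f : Sym2 V → ℝ) :
    2 * ∑ e ∈ G.edgeFinset, f e = ∑ x, ∑ y, if G.Adj x y then f s(x, y) else 0 := by
  rw [← Finset.sum_product', ← Finset.sum_filter]
  rw [← Finset.sum_fiberwise_of_maps_to (t := G.edgeFinset) (g := fun x : V × V => s(x.1, x.2))
    (by intro x hx; simpa using hx), Finset.mul_sum]
  refine Finset.sum_congr rfl fun e he => ?_
  induction e using Sym2.ind with
  | _ x y =>
  rw [SimpleGraph.mem_edgeFinset, SimpleGraph.mem_edgeSet] at he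
  have : ((Finset.univ ×ˢ Finset.univ).filter fun z : V × V => G.Adj z.1 z.2).filter
      (fun z => s(z.1, z.2) = s(x, y)) = {(x, y), (y, x)} := by
    ext ⟨u, v⟩
    simp only [Finset.mem_filter, Finset.mem_product, Finset.mem_univ, true_and, Sym2.eq_iff,
      Finset.mem_insert, Finset.mem_singleton, Prod.mk.injEq, and_true]
    constructor
    · exact fun h => h.2
    · rintro (⟨rfl, rfl⟩ | ⟨rfl, rfl⟩)
      · exact ⟨he, by simp⟩
      · exact ⟨he.symm, by simp⟩
  rw [this, Finset.sum_pair (by simp [he.ne])]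
  simp only [Sym2.eq_swap (a := y)]
  ring

lemma pNorm_eq {p : ℝ} (hp : p ≠ 0) :
    (pNorm G c p : ℝ) = ((∑ x, ∑ y, adjCost G c x y ^ p) / 2) ^ (1 / p) := by
  classical
  have h := two_mul_sum_edgeFinset (G := G) fun e => (c e : ℝ) ^ p
  have h2 : ∑ x, ∑ y, adjCost G c x y ^ p
      = ∑ x, ∑ y, if G.Adj x y then (c s(x, y) : ℝ) ^ p else 0 := by
    refine Finset.sum_congr rfl fun x _ => Finset.sum_congr rfl fun y _ => ?_
    unfold adjCost
    split_ifs
    · rfl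
    · exact Real.zero_rpow hp
  rw [h2, ← h, mul_div_cancel_left₀ _ two_ne_zero, pNorm, NNReal.coe_rpow, NNReal.coe_sum]
  simp only [NNReal.coe_rpow]

/-- Apply the separator theorem with each vertex weighted by the p-th powers of its incident costs
inside W. The weight of a component bounds its power cost, and the total weight is that of W. -/
lemma HasSeparatorTheorem.hasCheapSeparators {p : ℝ} (hp : 0 < p) {C : ℝ≥0}
    (h : HasSeparatorTheorem G c p C) :
    HasCheapSeparators (adjCost G c) p C Finset.univ.val := by
  classical
  intro W hW
  obtain ⟨Wf, rfl⟩ : ∃ Wf : Finset V, Wf.val = W := ⟨⟨W, Multiset.nodup_of_le hW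
    Finset.univ.nodup⟩, rfl⟩
  have hpow : ∀ x y, 0 ≤ adjCost G c x y ^ p := fun x y =>
    Real.rpow_nonneg (adjCost_nonneg x y) p
  obtain ⟨Ws, hWs⟩ : ∃ Ws : Set V, ∀ v, v ∈ Wf ↔ v ∈ Ws := ⟨↑Wf, by simp⟩
  obtain ⟨S, hbal, hcost⟩ := h Ws fun x => (∑ y ∈ Wf, adjCost G c x y ^ p).toNNReal
  set H := (G.induce Ws).induce {v | v ∉ S} with hH
  have hWsum : ∑ v : Ws, ({(v : V)} : Multiset V) = Wf.val := by
    rw [← sum_singleton_eq_val]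
    exact (Finset.sum_subtype Wf hWs fun v => ({v} : Multiset V)).symm
  have hWpow : powerCost (adjCost G c) p Wf.val
      = ∑ x : Ws, ∑ y : Ws, adjCost G c x y ^ p := by
    rw [powerCost, ← hWsum, crossCost_sum_singleton]
  set Q : H.ConnectedComponent → Multiset V := fun K =>
    ∑ v : {v : Ws | v ∉ S} with H.connectedComponentMk v = K, {(v : V)} with hQ
  have htotal : ∑ K, Q K + ∑ s ∈ S, ({(s : V)} : Multiset V) = Wf.val := by
    rw [← hWsum, ← Finset.sum_compl_add_sum S]
    congr 1
    simp only [hQ]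
    rw [Finset.sum_subtype Sᶜ (p := fun v => v ∈ {v | v ∉ S}) (by simp)
      fun v : Ws => ({(v : V)} : Multiset V)]
    convert Finset.sum_fiberwise (Finset.univ : Finset {v : Ws | v ∉ S}) H.connectedComponentMk
      fun v => ({((v : Ws) : V)} : Multiset V)
  have hQW : ∀ K, Q K ≤ Wf.val := fun K => by
    rw [← htotal]
    refine le_trans ?_ (Multiset.le_add_right _ _)
    exact Finset.single_le_sum (f := Q) (fun _ _ => Multiset.zero_le _) (Finset.mem_univ K)
  refine ⟨∑ s ∈ S, {(s : V)}, Finset.univ.toList.map Q, ?_, ?_, ?_, ?_⟩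
  · rw [Finset.sum_map_toList, htotal]
  · rw [List.pairwise_map]
    refine (Finset.nodup_toList _).imp fun {K K'} hne => ?_
    simp only [hQ]
    rw [crossCost_sum_singleton]
    refine Finset.sum_eq_zero fun v hv => Finset.sum_eq_zero fun v' hv' => ?_
    refine adjCost_of_not_adj fun hadj => hne ?_
    rw [← (Finset.mem_filter.1 hv).2, ← (Finset.mem_filter.1 hv').2]
    exact SimpleGraph.ConnectedComponent.sound (SimpleGraph.Adj.reachable (by simpa [hH] using hadj))
  · intro X hX
    obtain ⟨K, -, rfl⟩ := List.mem_map.1 hX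
    have h1 : powerCost (adjCost G c) p (Q K)
        ≤ ∑ v : {v : Ws | v ∉ S} with H.connectedComponentMk v = K,
            ∑ y ∈ Wf, adjCost G c v y ^ p := by
      refine (crossCost_mono hpow le_rfl (hQW K)).trans ?_
      rw [← sum_singleton_eq_val]
      simp only [hQ]
      rw [crossCost_sum_singleton]
    have h2 := hbal K
    rw [← NNReal.coe_le_coe] at h2
    push_cast at h2
    have h3 : ∀ x : V, ((∑ y ∈ Wf, adjCost G c x y ^ p).toNNReal : ℝ)
        = ∑ y ∈ Wf, adjCost G c x y ^ p := fun x =>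
      Real.coe_toNNReal _ (Finset.sum_nonneg fun y _ => hpow x y)
    simp only [h3] at h2
    have h4 : ∑ x : Ws, ∑ y ∈ Wf, adjCost G c x y ^ p = powerCost (adjCost G c) p Wf.val := by
      rw [powerCost, crossCost_val]
      exact (Finset.sum_subtype Wf hWs fun x => ∑ y ∈ Wf, adjCost G c x y ^ p).symm
    refine h1.trans ?_
    rw [← h4]
    refine le_of_eq_of_le ?_ h2
    congr!
  · rw [← NNReal.coe_le_coe] at hcost
    push_cast at hcost
    rw [pNorm_eq hp.ne'] at hcost
    simp only [adjCost_induce] at hcost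
    rw [← hWpow] at hcost
    have h1 : (separatorCost (G.induce Ws) (restrictCost c Ws) S : ℝ)
        = crossCost (adjCost G c) Wf.val (∑ s ∈ S, {(s : V)}) := by
      rw [crossCost_comm adjCost_comm, ← hWsum, crossCost_sum_singleton, separatorCost,
        NNReal.coe_sum]
      refine Finset.sum_congr rfl fun s _ => ?_
      rw [boundaryCost_singleton]
      simp only [adjCost_induce]
    rw [h1] at hcost
    -- The p-norm is the root of half the power cost, since edges count twice there; the half is
    -- dropped.
    refine hcost.trans ?_
    have := powerCost_nonneg (a := adjCost G c) adjCost_nonneg p Wf.val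
    refine mul_le_mul_of_nonneg_left (Real.rpow_le_rpow (by positivity) (by linarith)
      (by positivity)) C.coe_nonneg

/-- In the sum every vertex has multiplicity one, so it lies in exactly one class. -/
lemma exists_coloring {k : ℕ} (Cl : ℕ → Multiset V)
    (h : ∑ i ∈ Finset.range k, Cl i = Finset.univ.val) :
    ∃ χ : V → Fin k, ∀ i : Fin k, (colorClass χ i).val = Cl i := by
  classical
  have hcount : ∀ v, ∑ i ∈ Finset.range k, (Cl i).count v = 1 := fun v => by
    rw [← Multiset.count_sum', h, Multiset.count_eq_one_of_mem Finset.univ.nodup (by simp)]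
  have hex : ∀ v, ∃ i : Fin k, v ∈ Cl i := fun v => by
    by_contra! hcon
    have : ∑ i ∈ Finset.range k, (Cl i).count v = 0 :=
      Finset.sum_eq_zero fun i hi =>
        Multiset.count_eq_zero.2 (hcon ⟨i, Finset.mem_range.1 hi⟩)
    rw [hcount v] at this
    exact one_ne_zero this
  choose χ hχ using hex
  refine ⟨χ, fun i => ?_⟩
  have huniq : ∀ v, v ∈ Cl i → χ v = i := by
    intro v hv
    by_contra hne
    have hsub : ({(χ v : ℕ), (i : ℕ)} : Finset ℕ) ⊆ Finset.range k := by
      intro j hj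
      rw [Finset.mem_insert, Finset.mem_singleton] at hj
      rcases hj with rfl | rfl <;> simp
    have := Finset.sum_le_sum_of_subset (f := fun j => (Cl j).count v) hsub
    rw [Finset.sum_pair (by simpa [Fin.ext_iff] using hne), hcount v] at this
    have h1 := Multiset.one_le_count_iff_mem.2 (hχ v)
    have h2 := Multiset.one_le_count_iff_mem.2 hv
    omega
  have hnd : (Cl i).Nodup := by
    refine Multiset.nodup_of_le ?_ Finset.univ.nodup
    rw [← h]
    exact Finset.single_le_sum (f := Cl) (fun _ _ => Multiset.zero_le _)
      (Finset.mem_range.2 i.2)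
  refine (Multiset.Nodup.ext (colorClass χ i).nodup hnd).2 fun v => ?_
  rw [Finset.mem_val, colorClass, Finset.mem_filter]
  exact ⟨fun hv => hv.2 ▸ hχ v, fun hv => ⟨Finset.mem_univ v, huniq v hv⟩⟩

end Graphs
-- Costs in disjoint copies
section Copies

variable {V : Type*} {G : SimpleGraph V} {c : Sym2 V → ℝ≥0}

open Classical in
lemma adjCost_copies (m : ℕ) (x y : Fin m × V) :
    adjCost (copies G m) (copiesCost c m) x y = if x.1 = y.1 then adjCost G c x.2 y.2 else 0 := by
  by_cases h : (copies G m).Adj x y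
  · rw [adjCost_of_adj h, if_pos h.1, adjCost_of_adj h.2]
    simp [copiesCost]
  · rw [adjCost_of_not_adj h]
    split_ifs with h1
    · exact (adjCost_of_not_adj fun h2 => h ⟨h1, h2⟩).symm
    · rfl

end Copies

/-! ### The upper bound -/

section UpperBound

variable {V : Type*} [Fintype V] {G : SimpleGraph V} {c : Sym2 V → ℝ≥0}

lemma powerCost_univ {p : ℝ} (hp : 0 < p) :
    powerCost (adjCost G c) p Finset.univ.val = 2 * (pNorm G c p : ℝ) ^ p := by
  rw [pNorm_eq hp.ne', ← Real.rpow_mul, one_div_mul_cancel hp.ne', Real.rpow_one, powerCost,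
    crossCost_val]
  · ring
  · exact div_nonneg (Finset.sum_nonneg fun x _ => Finset.sum_nonneg fun y _ =>
      Real.rpow_nonneg (adjCost_nonneg x y) p) zero_le_two

lemma adjCost_le_supNorm (x y : V) : adjCost G c x y ≤ supNorm G c := by
  classical
  by_cases h : G.Adj x y
  · rw [adjCost_of_adj h, NNReal.coe_le_coe, supNorm]
    exact Finset.le_sup (f := c) (by simpa using h)
  · rw [adjCost_of_not_adj h]; exact NNReal.coe_nonneg _

open Classical in
lemma sum_adjCost_le {D : ℕ} {v : V} (h : G.degree v ≤ D) :
    ∑ y, adjCost G c v y ≤ D * supNorm G c := by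
  have h1 : ∑ y, adjCost G c v y = ∑ y ∈ G.neighborFinset v, adjCost G c v y := by
    symm
    refine Finset.sum_subset (Finset.subset_univ _) fun y _ hy => adjCost_of_not_adj ?_
    simpa using hy
  rw [h1]
  refine (Finset.sum_le_card_nsmul _ _ _ fun y _ => adjCost_le_supNorm v y).trans ?_
  rw [nsmul_eq_mul, SimpleGraph.card_neighborFinset_eq_degree]
  have : (G.degree v : ℝ) ≤ D := by exact_mod_cast h
  gcongr

lemma boundaryCost_eq_zero_of_pNorm_eq_zero {p : ℝ} (hp : 0 < p) (h : pNorm G c p = 0)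
    (U : Finset V) : boundaryCost G c U = 0 := by
  classical
  have h0 : crossCost (adjCost G c) Finset.univ.val Finset.univ.val = 0 := by
    refine crossCost_eq_zero_of_powerCost_eq_zero adjCost_nonneg hp ?_
    rw [powerCost_univ hp, h, NNReal.coe_zero, Real.zero_rpow hp.ne', mul_zero]
  have h1 : (boundaryCost G c U : ℝ) ≤ 0 := by
    rw [boundaryCost_eq_outerCost, outerCost, ← h0]
    have h2 := crossCost_nonneg (a := adjCost G c) adjCost_nonneg U.val U.val
    have h3 := crossCost_mono (a := adjCost G c) adjCost_nonneg
      (Finset.val_le_iff.2 (Finset.subset_univ U)) (le_refl Finset.univ.val)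
    linarith
  exact le_antisymm (by exact_mod_cast h1) zero_le

/-- Cheap orders give strictly balanced colorings with small maximum boundary cost. -/
lemma HasCheapOrders.exists_strictlyBalanced {p σ κ b : ℝ} (hp : 1 < p) (hσ : 0 ≤ σ)
    (hκ0 : 0 ≤ κ) (hκ : 16 * σ ≤ κ * (2 - 2 ^ (1 / p)))
    (h : HasCheapOrders (adjCost G c) p σ Finset.univ.val) (hb : 0 < b)
    (hdeg : ∀ v, ∑ y, adjCost G c v y ≤ b) {k : ℕ} (hk : 0 < k)
    (hnorm : (pNorm G c p : ℝ) / (k : ℝ) ^ (1 / p) ≤ b) (w : V → ℝ≥0) :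
    ∃ χ : V → Fin k, StrictlyBalanced w χ ∧ ∀ i,
      (boundaryCost G c (colorClass χ i) : ℝ)
        ≤ (2 * ⌈4 + 2 * κ⌉₊ + 4) * ((2 + 4 * σ) * b) := by
  have hp0 : 0 < p := by linarith
  have hkpos : (0 : ℝ) < k := by exact_mod_cast hk
  have hdeg' : ∀ v, crossCost (adjCost G c) {v} Finset.univ.val ≤ b := fun v => by
    have : crossCost (adjCost G c) {v} Finset.univ.val = ∑ y, adjCost G c v y := by
      simp [crossCost]
    rw [this]; exact hdeg v
  have hpow : powerCost (adjCost G c) p Finset.univ.val ≤ k * (2 * b ^ p) := by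
    rw [powerCost_univ hp0]
    rw [div_le_iff₀ (Real.rpow_pos_of_pos hkpos _)] at hnorm
    have := Real.rpow_le_rpow (NNReal.coe_nonneg _) hnorm hp0.le
    rw [Real.mul_rpow hb.le (by positivity), ← Real.rpow_mul hkpos.le,
      one_div_mul_cancel hp0.ne', Real.rpow_one] at this
    linarith
  obtain ⟨Ls, hT, hlen, hLs⟩ := h.exists_fine_pieces adjCost_nonneg adjCost_comm adjCost_self hp
    hσ hb hκ0 hκ hdeg' hk hpow
  have hq : 4 + 2 * κ ≤ ⌈4 + 2 * κ⌉₊ := Nat.le_ceil _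
  have hlen' : Ls.length ≤ ⌈4 + 2 * κ⌉₊ * k := by
    have : (Ls.length : ℝ) ≤ ⌈4 + 2 * κ⌉₊ * k := hlen.trans (by gcongr)
    exact_mod_cast this
  obtain ⟨Cl, hsum, hCl⟩ := exists_balanced_division adjCost_nonneg (w := fun v => (w v : ℝ))
    (fun v => NNReal.coe_nonneg _) (M := (Finset.univ.sup w : ℝ≥0)) (NNReal.coe_nonneg _)
    (fun v => NNReal.coe_le_coe.2 (Finset.le_sup (Finset.mem_univ v)))
    (B := (2 + 4 * σ) * b) (by positivity) hk (Nat.ceil_pos.2 (by linarith)) Ls hT hlen' hLs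
    (fun v => by
      have h1 := crossCost_nonneg (a := adjCost G c) adjCost_nonneg {v} {v}
      have h2 := hdeg' v
      have h3 : 0 ≤ σ * b := by positivity
      simp only [outerCost]
      linarith)
  obtain ⟨χ, hχ⟩ := exists_coloring Cl hsum
  refine ⟨χ, fun i => ?_, fun i => ?_⟩
  · have := (hCl i i.2).2
    rw [← hχ i] at this
    push_cast
    exact this
  · rw [boundaryCost_eq_outerCost, hχ i]
    exact (hCl i i.2).1

lemma exists_decompositionCost_le (p : ℝ) (hp : 1 < p) (D : ℕ) (L C : ℝ≥0) : ∃ K : ℝ≥0,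
    ∀ (V : Type u) [Fintype V] (G : SimpleGraph V) (c : Sym2 V → ℝ≥0),
      WellBehaved G c D L → HasSeparatorTheorem G c p C → ∀ k : ℕ, 0 < k →
        decompositionCost G c k ≤
          ((K * (pNorm G c p / (k : ℝ≥0) ^ (1 / p) + supNorm G c) : ℝ≥0) : ℝ≥0∞) := by
  classical
  have hp0 : 0 < p := by linarith
  have hρ : ((2 : ℝ) / 3) ^ (1 / p) < 1 :=
    Real.rpow_lt_one (by norm_num) (by norm_num) (by positivity)
  have hr : (2 : ℝ) ^ (1 / p) < 2 := by
    calc (2 : ℝ) ^ (1 / p) < 2 ^ (1 : ℝ) :=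
          Real.rpow_lt_rpow_of_exponent_lt (by norm_num) (by rw [div_lt_one hp0]; exact hp)
      _ = 2 := by simp
  have hρ' : 0 < 1 - ((2 : ℝ) / 3) ^ (1 / p) := by linarith
  have hr' : 0 < 2 - (2 : ℝ) ^ (1 / p) := by linarith
  -- The sum of the geometric series, hence the fixed point of σ ↦ σ(2/3)^(1/p) + C.
  set σ : ℝ := C / (1 - (2 / 3) ^ (1 / p)) with hσ
  have hσ0 : 0 ≤ σ := by positivity
  have hσC : σ * (2 / 3) ^ (1 / p) + C ≤ σ := by
    have : σ * (1 - (2 / 3) ^ (1 / p)) = C := by rw [hσ]; field_simp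
    linarith
  set κ : ℝ := 16 * σ / (2 - 2 ^ (1 / p)) with hκ
  have hκ0 : 0 ≤ κ := by positivity
  have hκσ : 16 * σ ≤ κ * (2 - 2 ^ (1 / p)) := by
    rw [hκ, div_mul_cancel₀ _ hr'.ne']
  set K₀ : ℝ := (2 * ⌈4 + 2 * κ⌉₊ + 4) * (2 + 4 * σ) with hK₀
  have hK₀0 : 0 ≤ K₀ := by positivity
  refine ⟨K₀.toNNReal * (1 + D), fun V _ G c hG hsep k hk => iSup_le fun w => ?_⟩
  have hord := (hsep.hasCheapSeparators hp0).hasCheapOrders adjCost_nonneg hp0 hσ0 hσC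
  set β : ℝ≥0 := pNorm G c p / (k : ℝ≥0) ^ (1 / p) + supNorm G c with hβ
  have hk' : (0 : ℝ≥0) < (k : ℝ≥0) ^ (1 / p) := NNReal.rpow_pos (by exact_mod_cast hk)
  -- The factor 1 + D covers both the norm term and the cost D‖c‖_∞ at a vertex. A free b > 0 admits
  -- β = 0, where all costs vanish and b = 1 serves for balance alone.
  have main : ∀ b : ℝ, 0 < b → (1 + D) * (β : ℝ) ≤ b → ∃ χ : V → Fin k, StrictlyBalanced w χ ∧
      ∀ i, (boundaryCost G c (colorClass χ i) : ℝ) ≤ K₀ * b := by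
    intro b hb hle
    have hβc : (β : ℝ) = (pNorm G c p : ℝ) / (k : ℝ) ^ (1 / p) + supNorm G c := by
      rw [hβ]; push_cast; rfl
    have hn : 0 ≤ (pNorm G c p : ℝ) / (k : ℝ) ^ (1 / p) := by positivity
    have hs : (0 : ℝ) ≤ supNorm G c := NNReal.coe_nonneg _
    have hD : (0 : ℝ) ≤ D := Nat.cast_nonneg D
    obtain ⟨χ, h1, h2⟩ := hord.exists_strictlyBalanced hp hσ0 hκ0 hκσ hb
      (fun v => (sum_adjCost_le (hG.1 v)).trans (le_trans (by rw [hβc]; nlinarith) hle)) hk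
      (le_trans (by rw [hβc]; nlinarith) hle) w
    exact ⟨χ, h1, fun i => (h2 i).trans_eq (by rw [hK₀]; ring)⟩
  obtain ⟨χ, hbal, hχ⟩ : ∃ χ : V → Fin k, StrictlyBalanced w χ ∧
      ∀ i, boundaryCost G c (colorClass χ i) ≤ K₀.toNNReal * (1 + D) * β := by
    rcases eq_or_lt_of_le (zero_le (a := β)) with h0 | hpos
    · obtain ⟨χ, hbal, -⟩ := main 1 one_pos (by rw [← h0]; simp)
      refine ⟨χ, hbal, fun i => ?_⟩
      have : pNorm G c p = 0 := by
        have h1 := (add_eq_zero.1 (hβ.symm.trans h0.symm)).1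
        rcases div_eq_zero_iff.1 h1 with h | h
        · exact h
        · exact absurd h hk'.ne'
      rw [boundaryCost_eq_zero_of_pNorm_eq_zero hp0 this]
      exact zero_le
    · obtain ⟨χ, hbal, hχ⟩ := main ((1 + D) * β)
        (mul_pos (by positivity) (by exact_mod_cast hpos)) le_rfl
      refine ⟨χ, hbal, fun i => ?_⟩
      rw [← NNReal.coe_le_coe]
      push_cast
      rw [Real.coe_toNNReal _ hK₀0, mul_assoc]
      exact hχ i
  refine iInf_le_of_le ⟨χ, hbal⟩ ?_
  rw [ENNReal.coe_le_coe]
  exact Finset.sup_le fun i _ => hχ i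

end UpperBound

/-! ### The lower bound -/

section LowerBound

variable {V : Type*} [Fintype V] {G : SimpleGraph V} {c : Sym2 V → ℝ≥0}

open Classical in
/-- The vertices incident to a bichromatic edge. -/
noncomputable def bichromaticVertices {ι : Type*} (G : SimpleGraph V) (f : V → ι) : Finset V :=
  Finset.univ.filter fun v => ∃ u, G.Adj v u ∧ f v ≠ f u

lemma mem_bichromaticVertices {ι : Type*} {f : V → ι} {v : V} :
    v ∈ bichromaticVertices G f ↔ ∃ u, G.Adj v u ∧ f v ≠ f u := by
  simp [bichromaticVertices]

/-- By bounded fluctuation, a single bichromatic edge at s pays for all of δ(s) up to the factor L.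
-/
lemma separatorCost_bichromaticVertices_le {ι : Type*} [DecidableEq ι] {D : ℕ} {L : ℝ≥0}
    (h : WellBehaved G c D L) (f : V → ι) :
    (separatorCost G c (bichromaticVertices G f) : ℝ)
      ≤ L * ∑ x, ∑ y, if f x ≠ f y then adjCost G c x y else 0 := by
  classical
  rw [separatorCost, NNReal.coe_sum, Finset.mul_sum]
  have h0 : ∀ x y, 0 ≤ if f x ≠ f y then adjCost G c x y else 0 := fun x y => by
    split_ifs
    · exact adjCost_nonneg x y
    · exact le_rfl
  refine (Finset.sum_le_sum fun s hs => ?_).trans (Finset.sum_le_sum_of_subset_of_nonneg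
    (Finset.subset_univ (bichromaticVertices G f))
    fun s _ _ => mul_nonneg L.coe_nonneg (Finset.sum_nonneg fun y _ => h0 s y))
  obtain ⟨y, hadj, hne⟩ := mem_bichromaticVertices.1 hs
  have hcut : s(s, y) ∈ cut G {s} := by
    simp only [cut, Finset.mem_filter, SimpleGraph.mem_edgeFinset, SimpleGraph.mem_edgeSet]
    exact ⟨hadj, s, y, by simp, by simpa using hadj.ne', rfl⟩
  have h1 : (boundaryCost G c {s} : ℝ) ≤ L * adjCost G c s y := by
    rw [adjCost_of_adj hadj]
    exact_mod_cast h.2 s _ hcut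
  refine h1.trans (mul_le_mul_of_nonneg_left ?_ L.coe_nonneg)
  have := Finset.single_le_sum (fun y _ => h0 s y) (Finset.mem_univ y)
  rwa [if_pos hne] at this

/-- Edges between the remaining vertices are monochromatic, so each component lies in one color
class. -/
lemma isBalancedSeparator_bichromaticVertices {ι : Type*} [DecidableEq ι] (w : V → ℝ≥0)
    (f : V → ι) (h : ∀ i, ∑ v with f v = i, w v ≤ 2 / 3 * ∑ v, w v) :
    IsBalancedSeparator G w (bichromaticVertices G f) := by
  classical
  have hreach : ∀ x y, (G.induce {v | v ∉ bichromaticVertices G f}).Reachable x y →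
      f x = f y := by
    rintro x y ⟨p⟩
    induction p with
    | nil => rfl
    | @cons x y _ hadj _ ih =>
      refine Eq.trans ?_ ih
      by_contra hne
      exact x.2 (mem_bichromaticVertices.2 ⟨y, by simpa using hadj, hne⟩)
  intro K
  obtain ⟨r, rfl⟩ := K.exists_rep
  refine le_trans ?_ (h (f r))
  refine (Finset.sum_map _ (Function.Embedding.subtype
    fun v => v ∈ {v | v ∉ bichromaticVertices G f}) w).ge.trans ?_
  refine Finset.sum_le_sum_of_subset fun v hv => ?_
  obtain ⟨x, hx, rfl⟩ := Finset.mem_map.1 hv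
  have hx' := (Finset.mem_filter.1 hx).2
  exact Finset.mem_filter.2 ⟨Finset.mem_univ _,
    hreach x r (SimpleGraph.ConnectedComponent.exact hx')⟩

open Classical in
lemma sum_boundaryCost_colorClass {k : ℕ} (χ : V → Fin k) :
    ∑ i, (boundaryCost G c (colorClass χ i) : ℝ)
      = ∑ x, ∑ y, if χ x ≠ χ y then adjCost G c x y else 0 := by
  rw [← Finset.sum_fiberwise Finset.univ χ]
  refine Finset.sum_congr rfl fun i _ => ?_
  rw [boundaryCost_eq_sum]
  unfold colorClass
  refine Finset.sum_congr (by congr!) fun x hx => ?_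
  rw [Finset.mem_filter] at hx
  rw [← Finset.sum_filter, Finset.compl_filter]
  refine Finset.sum_congr ?_ fun _ _ => rfl
  ext y
  simp [hx.2, eq_comm]

lemma pNorm_copies_le {p : ℝ} (hp : 0 < p) (m : ℕ) :
    (pNorm (copies G m) (copiesCost c m) p : ℝ) ≤ (m : ℝ) ^ (1 / p) * pNorm G c p := by
  classical
  rw [pNorm_eq hp.ne', pNorm_eq hp.ne', ← Real.mul_rpow (by positivity)]
  · refine le_of_eq ?_
    congr 1
    rw [← mul_div_assoc]
    congr 1
    rw [Fintype.sum_prod_type]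
    have : ∀ (j : Fin m) (x : V), ∑ y, adjCost (copies G m) (copiesCost c m) (j, x) y ^ p
        = ∑ y, adjCost G c x y ^ p := by
      intro j x
      rw [Fintype.sum_prod_type, Finset.sum_eq_single j]
      · simp [adjCost_copies]
      · intro i _ hi
        simp [adjCost_copies, hi.symm, Real.zero_rpow hp.ne']
      · simp
    simp [this]
  · exact div_nonneg (Finset.sum_nonneg fun x _ => Finset.sum_nonneg fun y _ =>
      Real.rpow_nonneg (adjCost_nonneg x y) p) zero_le_two

lemma supNorm_copies_le (m : ℕ) : supNorm (copies G m) (copiesCost c m) ≤ supNorm G c := by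
  classical
  refine Finset.sup_le fun e he => ?_
  induction e using Sym2.ind with
  | _ x y =>
  rw [SimpleGraph.mem_edgeFinset, SimpleGraph.mem_edgeSet] at he
  exact Finset.le_sup (f := c) (b := s(x.2, y.2)) (by simpa using he.2)

lemma supNorm_le_pNorm {p : ℝ} (hp : 0 < p) : supNorm G c ≤ pNorm G c p := by
  classical
  refine Finset.sup_le fun e he => ?_
  calc c e = (c e ^ p) ^ (1 / p) := by
        rw [← NNReal.rpow_mul, mul_one_div_cancel hp.ne', NNReal.rpow_one]
    _ ≤ pNorm G c p := by
        refine NNReal.rpow_le_rpow ?_ (by positivity)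
        exact Finset.single_le_sum (f := fun e => c e ^ p) (fun _ _ => zero_le) he

/-- A strictly balanced coloring of the copies yields a cheap balanced separator of `G`. -/
lemma separator_bound_le_maxBoundaryCost {D : ℕ} {L : ℝ≥0} (h : WellBehaved G c D L)
    {w : V → ℝ≥0} (hw : Finset.univ.sup w ≤ (∑ v, w v) / 4) {A : ℝ≥0}
    (hA : ∀ S : Finset V, IsBalancedSeparator G w S → A ≤ separatorCost G c S)
    {m : ℕ} (hm : 0 < m) {k : ℕ} (hk : k = 4 * m) (χ : Fin m × V → Fin k)
    (hχ : StrictlyBalanced (fun x => w x.2) χ) :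
    (A : ℝ) ≤ 4 * L * maxBoundaryCost (copies G m) (copiesCost c m) χ := by
  classical
  have hmpos : (0 : ℝ) < m := by exact_mod_cast hm
  have hkr : (k : ℝ) = 4 * m := by rw [hk]; push_cast; rfl
  have hwsum : ((∑ x : Fin m × V, w x.2 : ℝ≥0) : ℝ) / k = ((∑ v, w v : ℝ≥0) : ℝ) / 4 := by
    rw [Fintype.sum_prod_type]
    simp only [Finset.sum_const, Finset.card_univ, Fintype.card_fin, nsmul_eq_mul]
    push_cast
    rw [hkr]
    field_simp
  have hwr : ((Finset.univ.sup w : ℝ≥0) : ℝ) ≤ ((∑ v, w v : ℝ≥0) : ℝ) / 4 := by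
    exact_mod_cast hw
  have hsup : ((Finset.univ.sup fun x : Fin m × V => w x.2 : ℝ≥0) : ℝ)
      ≤ ((∑ v, w v : ℝ≥0) : ℝ) / 4 := by
    refine le_trans (NNReal.coe_le_coe.2 (Finset.sup_le fun x _ => ?_)) hwr
    exact Finset.le_sup (Finset.mem_univ x.2)
  -- As k = 4m, the average class weight is ‖w‖₁/4. The deviation is at most ‖w‖_∞ ≤ ‖w‖₁/4, so a
  -- whole class weighs at most ‖w‖₁/2.
  have hclass : ∀ (j : Fin m) (i : Fin k), ∑ v with χ (j, v) = i, w v ≤ 2 / 3 * ∑ v, w v := by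
    intro j i
    have h1 : ∑ v with χ (j, v) = i, w v ≤ ∑ x ∈ colorClass χ i, w x.2 := by
      refine (Finset.sum_map (Finset.univ.filter fun v => χ (j, v) = i)
        (Function.Embedding.sectR j V) fun x => w x.2).ge.trans ?_
      refine Finset.sum_le_sum_of_subset fun x hx => ?_
      obtain ⟨v, hv, rfl⟩ := Finset.mem_map.1 hx
      exact Finset.mem_filter.2 ⟨Finset.mem_univ _, (Finset.mem_filter.1 hv).2⟩
    have h2 := (abs_le.1 (hχ i)).2
    rw [hwsum] at h2
    have h3 : (1 - 1 / (k : ℝ)) * ((Finset.univ.sup fun x : Fin m × V => w x.2 : ℝ≥0) : ℝ)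
        ≤ ((Finset.univ.sup fun x : Fin m × V => w x.2 : ℝ≥0) : ℝ) := by
      refine mul_le_of_le_one_left (NNReal.coe_nonneg _) ?_
      have : 0 ≤ 1 / (k : ℝ) := by positivity
      linarith
    refine h1.trans ?_
    rw [← NNReal.coe_le_coe]
    have h4 : (0 : ℝ) ≤ ((∑ v, w v : ℝ≥0) : ℝ) := NNReal.coe_nonneg _
    rw [NNReal.coe_mul]
    have h5 : ((2 / 3 : ℝ≥0) : ℝ) = 2 / 3 := by push_cast; rfl
    rw [h5]
    linarith
  set M : ℝ := ((maxBoundaryCost (copies G m) (copiesCost c m) χ : ℝ≥0) : ℝ) with hM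
  have htotal : ∑ j : Fin m, ∑ x, ∑ y, (if χ (j, x) ≠ χ (j, y) then adjCost G c x y else 0)
      ≤ k * M := by
    have h1 : ∑ i, (boundaryCost (copies G m) (copiesCost c m) (colorClass χ i) : ℝ)
        ≤ k * M := by
      refine (Finset.sum_le_card_nsmul Finset.univ _ M fun i _ => ?_).trans_eq (by simp)
      exact NNReal.coe_le_coe.2 (Finset.le_sup
        (f := fun i : Fin k => boundaryCost (copies G m) (copiesCost c m) (colorClass χ i))
        (Finset.mem_univ i))
    rw [sum_boundaryCost_colorClass, Fintype.sum_prod_type] at h1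
    refine le_of_eq_of_le (Finset.sum_congr rfl fun j _ => Finset.sum_congr rfl fun x _ => ?_) h1
    rw [Fintype.sum_prod_type, Finset.sum_eq_single j]
    · simp [adjCost_copies]
    · intro i _ hi
      simp [adjCost_copies, hi.symm]
    · simp
  -- Each of the m copies contributes a separator of cost at least A; dividing by m leaves the
  -- factor k/m = 4.
  have hsum : ∑ _j : Fin m, (A : ℝ) ≤ L * (k * M) := by
    refine le_trans ?_ (mul_le_mul_of_nonneg_left htotal L.coe_nonneg)
    rw [Finset.mul_sum]
    refine Finset.sum_le_sum fun j _ => ?_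
    refine le_trans ?_ (separatorCost_bichromaticVertices_le h fun v => χ (j, v))
    exact NNReal.coe_le_coe.2 (hA _ (isBalancedSeparator_bichromaticVertices w _ (hclass j)))
  rw [Finset.sum_const, Finset.card_univ, Fintype.card_fin, nsmul_eq_mul, hkr] at hsum
  have : (m : ℝ) * A ≤ m * (4 * L * M) := by linarith
  exact le_of_mul_le_mul_left this hmpos

lemma exists_le_decompositionCost (D : ℕ) (L : ℝ≥0) : ∃ κ : ℝ≥0, 0 < κ ∧
    ∀ (p : ℝ), 1 < p →
    ∀ (V : Type u) [Fintype V] (G : SimpleGraph V) (c : Sym2 V → ℝ≥0) (α : ℝ≥0),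
      WellBehaved G c D L →
      (∃ w : V → ℝ≥0, Finset.univ.sup w ≤ (∑ v, w v) / 4 ∧
        ∀ S : Finset V, IsBalancedSeparator G w S → α * pNorm G c p ≤ separatorCost G c S) →
        ∀ k : ℕ, 0 < k → 4 ∣ k →
          ((κ * (α * (pNorm (copies G (k / 4)) (copiesCost c (k / 4)) p / (k : ℝ≥0) ^ (1 / p)
            + supNorm (copies G (k / 4)) (copiesCost c (k / 4)))) : ℝ≥0) : ℝ≥0∞)
            ≤ decompositionCost (copies G (k / 4)) (copiesCost c (k / 4)) k := by
  -- 8 = 4 · 2: the factor 4 of `separator_bound_le_maxBoundaryCost`, and 2 because each of the two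
  -- norm terms is at most ‖c‖_p. L + 1 avoids division by zero.
  refine ⟨1 / (8 * (L + 1)), by positivity, ?_⟩
  rintro p hp V _ G c α hG ⟨w, hw, hS⟩ k hk ⟨m, hkm⟩
  have hp0 : 0 < p := by linarith
  have hm : 0 < m := by omega
  have hdiv : k / 4 = m := by omega
  rw [hdiv]
  have hnorm : pNorm (copies G m) (copiesCost c m) p / (k : ℝ≥0) ^ (1 / p) ≤ pNorm G c p := by
    have hk' : (0 : ℝ≥0) < (k : ℝ≥0) ^ (1 / p) := NNReal.rpow_pos (by exact_mod_cast hk)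
    rw [div_le_iff₀ hk', mul_comm]
    have h1 : pNorm (copies G m) (copiesCost c m) p ≤ (m : ℝ≥0) ^ (1 / p) * pNorm G c p := by
      rw [← NNReal.coe_le_coe]
      push_cast
      exact pNorm_copies_le hp0 m
    refine h1.trans (mul_le_mul_left ?_ _)
    exact NNReal.rpow_le_rpow (by exact_mod_cast (by omega : m ≤ k)) (by positivity)
  have hbound : pNorm (copies G m) (copiesCost c m) p / (k : ℝ≥0) ^ (1 / p)
      + supNorm (copies G m) (copiesCost c m) ≤ 2 * pNorm G c p := by
    rw [two_mul]
    exact add_le_add hnorm ((supNorm_copies_le m).trans (supNorm_le_pNorm hp0))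
  refine le_iSup_of_le (fun x => w x.2) (le_iInf fun χ => ?_)
  rw [ENNReal.coe_le_coe]
  have h := separator_bound_le_maxBoundaryCost hG hw hS hm hkm χ.1 χ.2
  set M := maxBoundaryCost (copies G m) (copiesCost c m) χ.1
  have h' : α * pNorm G c p ≤ 4 * L * M := by exact_mod_cast h
  calc _ ≤ 1 / (8 * (L + 1)) * (α * (2 * pNorm G c p)) := by gcongr
    _ = 1 / (8 * (L + 1)) * (2 * (α * pNorm G c p)) := by ring
    _ ≤ 1 / (8 * (L + 1)) * (2 * (4 * (L + 1) * M)) := by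
        have h'' : α * pNorm G c p ≤ 4 * (L + 1) * M := by
          refine h'.trans ?_
          gcongr
          exact le_self_add
        exact mul_le_mul_right (mul_le_mul_right h'' 2) _
    _ = M := by field_simp; ring

end LowerBound
end MinMaxBoundary

theorem mainTheorem2 :
    (∀ (p : ℝ), 1 < p → ∀ (D : ℕ) (L C : ℝ≥0), ∃ K : ℝ≥0,
      ∀ (V : Type u) [Fintype V] (G : SimpleGraph V) (c : Sym2 V → ℝ≥0),
        WellBehaved G c D L → HasSeparatorTheorem G c p C →
          ∀ k : ℕ, 0 < k →
            decompositionCost G c k ≤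
              ((K * (pNorm G c p / (k : ℝ≥0) ^ (1 / p) + supNorm G c) : ℝ≥0) : ℝ≥0∞))
    ∧
    (∀ (D : ℕ) (L : ℝ≥0), ∃ κ : ℝ≥0, 0 < κ ∧
      ∀ (p : ℝ), 1 < p →
      ∀ (V : Type u) [Fintype V] (G : SimpleGraph V) (c : Sym2 V → ℝ≥0) (α : ℝ≥0),
        WellBehaved G c D L →
        (∃ w : V → ℝ≥0, Finset.univ.sup w ≤ (∑ v, w v) / 4 ∧
          ∀ S : Finset V, IsBalancedSeparator G w S →
            α * pNorm G c p ≤ separatorCost G c S) →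
          ∀ k : ℕ, 0 < k → 4 ∣ k →
            ((κ * (α * (pNorm (copies G (k / 4)) (copiesCost c (k / 4)) p
                / (k : ℝ≥0) ^ (1 / p)
              + supNorm (copies G (k / 4)) (copiesCost c (k / 4)))) : ℝ≥0) : ℝ≥0∞)
              ≤ decompositionCost (copies G (k / 4)) (copiesCost c (k / 4)) k) :=
  ⟨exists_decompositionCost_le, exists_le_decompositionCost⟩
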